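/- **Setting.** Let $\Theta\subset\mathbb R^d$ be compact and, for $\theta\in\Theta$, let $\nu_\theta$ be a probability measure on the set of probability vectors $p=(p(-2),p(-1),p(1))$. Under $\mathbb P^\theta=\nu_\theta^{\otimes\mathbb Z}$ the environment $\omega=(\omega_x)_{x\in\mathbb Z}$ is i.i.d. with marginal $\nu_\theta$. Given $\omega$, let $P_\omega$ be the law of the Markov chain $(X_t)_{t\ge0}$ on $\mathbb Z$ with $X_0=0$ and $P_\omega(X_{t+1}=x+l\mid X_t=x)=\omega_x(l)$ for $l=-2,-1,1$. Put $a_k=\omega_k(-1)/\omega_k(1)$, $b_k=\omega_k(-2)/\omega_k(1)$ and $$A_k=\begin{pmatrix}a_k&b_k&0\\a_k&b_k&1\\a_k&b_k&0\end{pmatrix}.$$ Assume * (C1) $\inf_{\theta\in\Theta}\mathbb E^\theta[\log\omega_0(l)]>-\infty$ for $l=-2,-1,1$ (with $\log 0=-\infty$); * (C2) for every $\theta\in\Theta$ the top Lyapunov exponent $\gamma_A=\lim_{n\to\infty}\frac1n\mathbb E^\theta\log\|A_0A_1\cdots A_{n-1}\|$ is negative. For $n\ge1$ let $T_n=\inf\{t>0:X_t=n\}$,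 and for $i\in\mathbb Z$ let $\mathbf U^n_i=(U^n_{i,1},U^n_{i,2},U^n_{i,3})$ be the vector of the numbers of times $k$ with $0<k<T_n$ at which $(X_{k-1},X_k)$ equals $(i,i-1)$, $(i,i-2)$, $(i+1,i-1)$, respectively. **Theorem.** Let $\theta\in\Theta$. For $\mathbb P^\theta$-almost every $\omega$ and every $n\ge1$ the following hold. 1. $\mathbf U^n_n=0$ $P_\omega$-almost surely, and under $P_\omega$ the sequence $(\mathbf U^n_n,\mathbf U^n_{n-1},\dots,\mathbf U^n_0)$ has the same law as the first generations $(Z_0,Z_1,\dots,Z_n)$ of the following $3$-type branching process with immigration: $Z_0=0$; at each time $m=n-(i+1)$, $0\le i\le n-1$, one type-$1$ individual immigrates; then this immigrant and the individuals counted by $Z_m$ independently give birth, and $Z_{m+1}$ is the vector of the total numbers of their children of each type. The numbers of children (of types $1,2,3$) of an individual of type $1$, $2$, $3$ living at time $m=n-(i+1)$ are respectively $(a,b,0)$, $(a,b,1)$, $(a,b,0)$ with probability $$\frac{(a+b)!}{a!\,b!}\,\omega_i(-1)^a\,\omega_i(-2)^b\,\omega_i(1),\qquad a,b\in\{0,1,2,\dots\}.$$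 2. $P_\omega$-almost surely $T_n<\infty$ and $$T_n=n+\sum_{k=-\infty}^{n-1}\mathbf U^n_k\,(2,1,2)^t=n+\sum_{k=-\infty}^{n-1}\bigl(2U^n_{k,1}+U^n_{k,2}+2U^n_{k,3}\bigr).$$ -/

import Mathlib

open MeasureTheory ProbabilityTheory Filter Topology
open scoped Nat

namespace RWRE

/-! ### Environment, quenched walk -/

/-- A probability vector `(p(-2), p(-1), p(1))` on the possible jumps `-2, -1, 1`, stored as the
coordinates `0, 1, 2`. -/
abbrev StepLaw : Type := stdSimplex ℝ (Fin 3)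

/-- The probability `p(l)` of the jump `l`. -/
def prob (p : StepLaw) (l : ℤ) : ℝ :=
  if l = -2 then p 0 else if l = -1 then p 1 else if l = 1 then p 2 else 0

/-- An environment: a jump law at each site of `ℤ`. -/
abbrev Env : Type := ℤ → StepLaw

/-- The law of an i.i.d. environment whose one-site marginal is `ν`. -/
noncomputable def envLaw (ν : Measure StepLaw) [IsProbabilityMeasure ν] : Measure Env :=
  Measure.infinitePi fun _ : ℤ => ν

/-- The law of the position after one step of the walk from `x` in the environment `ω`. -/
noncomputable def stepMeasure (ω : Env) (x : ℤ) : Measure ℤ :=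
  ENNReal.ofReal (prob (ω x) (-2)) • Measure.dirac (x - 2)
    + ENNReal.ofReal (prob (ω x) (-1)) • Measure.dirac (x - 1)
    + ENNReal.ofReal (prob (ω x) 1) • Measure.dirac (x + 1)

theorem prob_nonneg (p : StepLaw) (l : ℤ) : 0 ≤ prob p l := by
  unfold prob
  split_ifs
  · exact p.2.1 0
  · exact p.2.1 1
  · exact p.2.1 2
  · exact le_rfl

theorem prob_sum (p : StepLaw) : prob p (-2) + prob p (-1) + prob p 1 = 1 := by
  have h := p.2.2
  rw [Fin.sum_univ_three] at h
  change p 0 + p 1 + p 2 = 1 at h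
  simpa [prob] using h

instance isProbabilityMeasure_stepMeasure (ω : Env) (x : ℤ) :
    IsProbabilityMeasure (stepMeasure ω x) := by
  constructor
  simp only [stepMeasure, Measure.add_apply, Measure.smul_apply, measure_univ, smul_eq_mul,
    mul_one]
  rw [← ENNReal.ofReal_add (prob_nonneg _ _) (prob_nonneg _ _),
    ← ENNReal.ofReal_add (add_nonneg (prob_nonneg _ _) (prob_nonneg _ _)) (prob_nonneg _ _),
    prob_sum, ENNReal.ofReal_one]

/-- The transition kernel of the walk from its history up to time `t` to its position at time
`t + 1`; it only uses the current position. -/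
noncomputable def stepKernel (ω : Env) (t : ℕ) :
    Kernel ((i : Finset.Iic t) → (fun _ : ℕ => ℤ) i) ℤ :=
  Kernel.ofFunOfCountable fun h => stepMeasure ω (h ⟨t, Finset.mem_Iic.2 le_rfl⟩)

instance isMarkovKernel_stepKernel (ω : Env) (t : ℕ) : IsMarkovKernel (stepKernel ω t) :=
  ⟨fun h => isProbabilityMeasure_stepMeasure ω (h ⟨t, Finset.mem_Iic.2 le_rfl⟩)⟩

/-- The quenched law `P_ω` of the walk `(X_0, X_1, …)` started from `X_0 = 0`: the law of the
Markov chain with the above transitions, on the space of paths. -/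
noncomputable def quenchedLaw (ω : Env) : Measure (ℕ → ℤ) :=
  Kernel.traj (X := fun _ => ℤ) (stepKernel ω) 0 (fun _ => 0)

/-! ### The conditions on the environment -/

/-- `inf_θ E^θ[log ω_0(l)] > -∞` for `l = -2, -1, 1`, with `log 0 = -∞`.  As `log ω_0(l) ≤ 0`,
finiteness of an expectation means that `ω_0(l) > 0` almost surely and `log ω_0(l)` is
integrable. -/
def UniformLogMoment {ι : Type*} (ν : ι → Measure StepLaw) : Prop :=
  ∀ l : ℤ, l = -2 ∨ l = -1 ∨ l = 1 →
    (∀ θ, (∀ᵐ p ∂ν θ, 0 < prob p l) ∧ Integrable (fun p => Real.log (prob p l)) (ν θ)) ∧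
    BddBelow (Set.range fun θ => ∫ p, Real.log (prob p l) ∂ν θ)

/-- The matrix with rows `(a, b, 0)`, `(a, b, 1)`, `(a, b, 0)`, where `a = p(-1) / p(1)` and
`b = p(-2) / p(1)`. -/
noncomputable def meanMatrix (p : StepLaw) : Matrix (Fin 3) (Fin 3) ℝ :=
  !![prob p (-1) / prob p 1, prob p (-2) / prob p 1, 0;
     prob p (-1) / prob p 1, prob p (-2) / prob p 1, 1;
     prob p (-1) / prob p 1, prob p (-2) / prob p 1, 0]

section Lyapunov

attribute [local instance] Matrix.linftyOpNormedAddCommGroup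

/-- The top Lyapunov exponent `lim_n (1/n) E log ‖A_0 A_1 ⋯ A_{n-1}‖` of the i.i.d. matrices
`A_k = meanMatrix ω_k`.  Under the logarithmic moment condition the limit exists by
subadditivity; it is written as a limsup in the extended reals so that it is always defined. -/
noncomputable def topLyapunov (ν : Measure StepLaw) [IsProbabilityMeasure ν] : EReal :=
  limsup (fun n : ℕ =>
    (((∫ ω, Real.log ‖((List.range n).map fun k => meanMatrix (ω (k : ℤ))).prod‖ ∂envLaw ν) / n
      : ℝ) : EReal)) atTop

end Lyapunov

/-! ### Hitting times and jump counts of a path -/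

/-- `T_n = inf {t > 0 : X_t = n}`, with value `⊤` if `n` is never hit. -/
noncomputable def hittingTime (n : ℤ) (X : ℕ → ℤ) : ℕ∞ :=
  ⨅ (t : ℕ) (_ : 0 < t ∧ X t = n), (t : ℕ∞)

/-- `U^n_i`: the numbers of jumps `i → i - 1`, `i → i - 2` and `i + 1 → i - 1` before `T_n`. -/
noncomputable def jumpCount (n i : ℤ) (X : ℕ → ℤ) : Fin 3 → ℕ :=
  ![{k : ℕ | 0 < k ∧ (k : ℕ∞) < hittingTime n X ∧ X (k - 1) = i ∧ X k = i - 1}.ncard,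
    {k : ℕ | 0 < k ∧ (k : ℕ∞) < hittingTime n X ∧ X (k - 1) = i ∧ X k = i - 2}.ncard,
    {k : ℕ | 0 < k ∧ (k : ℕ∞) < hittingTime n X ∧ X (k - 1) = i + 1 ∧ X k = i - 1}.ncard]

/-! ### Offspring laws -/

/-- `(a+b)! / (a! b!) p(-1)^a p(-2)^b p(1)`. -/
noncomputable def pairMass (p : StepLaw) (v : ℕ × ℕ) : ℝ :=
  ((v.1 + v.2)! : ℝ) / ((v.1 ! : ℝ) * (v.2 ! : ℝ))
    * prob p (-1) ^ v.1 * prob p (-2) ^ v.2 * prob p 1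

theorem pairMass_nonneg (p : StepLaw) (v : ℕ × ℕ) : 0 ≤ pairMass p v := by
  have h1 := prob_nonneg p (-1)
  have h2 := prob_nonneg p (-2)
  have h3 := prob_nonneg p 1
  unfold pairMass
  positivity

theorem sum_antidiagonal_pairMass (p : StepLaw) (N : ℕ) :
    ∑ v ∈ Finset.HasAntidiagonal.antidiagonal N, pairMass p v
      = (prob p (-1) + prob p (-2)) ^ N * prob p 1 := by
  rw [(Commute.all (prob p (-1)) (prob p (-2))).add_pow', Finset.sum_mul]
  refine Finset.sum_congr rfl fun v hv => ?_
  have hN : v.1 + v.2 = N := Finset.HasAntidiagonal.mem_antidiagonal.1 hv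
  subst hN
  rw [pairMass, Nat.choose_symm_add, Nat.add_choose, nsmul_eq_mul,
    Nat.cast_div (Nat.factorial_mul_factorial_dvd_factorial_add _ _) (by positivity)]
  push_cast
  ring

theorem hasSum_pairMass (p : StepLaw) (h : 0 < prob p 1) :
    HasSum (fun v => ENNReal.ofReal (pairMass p v)) 1 := by
  have hs := prob_sum p
  have h1 := prob_nonneg p (-1)
  have h2 := prob_nonneg p (-2)
  rw [ENNReal.summable.hasSum_iff,
    ← (Finset.HasAntidiagonal.sigmaAntidiagonalEquivProd (A := ℕ)).tsum_eq, ENNReal.tsum_sigma']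
  have key : ∀ N : ℕ, ∑' v : Finset.HasAntidiagonal.antidiagonal N, ENNReal.ofReal
      (pairMass p (Finset.HasAntidiagonal.sigmaAntidiagonalEquivProd ⟨N, v⟩))
        = ENNReal.ofReal ((prob p (-1) + prob p (-2)) ^ N * prob p 1) := by
    intro N
    rw [tsum_fintype, ← sum_antidiagonal_pairMass,
      ENNReal.ofReal_sum_of_nonneg fun v _ => pairMass_nonneg p v]
    exact Finset.sum_coe_sort (Finset.HasAntidiagonal.antidiagonal N) fun v => ENNReal.ofReal (pairMass p v)
  simp_rw [key]
  have hg : HasSum (fun N : ℕ => (prob p (-1) + prob p (-2)) ^ N * prob p 1) 1 := by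
    have hg := (hasSum_geometric_of_lt_one (r := prob p (-1) + prob p (-2))
      (by linarith) (by linarith)).mul_right (prob p 1)
    have he : (1 - (prob p (-1) + prob p (-2)))⁻¹ * prob p 1 = 1 := by
      rw [show 1 - (prob p (-1) + prob p (-2)) = prob p 1 by linarith]
      exact inv_mul_cancel₀ h.ne'
    rwa [he] at hg
  rw [← ENNReal.ofReal_tsum_of_nonneg (fun N => by positivity) hg.summable, hg.tsum_eq,
    ENNReal.ofReal_one]

open Classical in
/-- The law of the pair `(a, b)` with masses `pairMass p`.  These masses add up to `1` if
`p(1) > 0`; in the excluded case `p(1) = 0` the value is arbitrary. -/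
noncomputable def pairLaw (p : StepLaw) : PMF (ℕ × ℕ) :=
  if h : 0 < prob p 1 then ⟨fun v => ENNReal.ofReal (pairMass p v), hasSum_pairMass p h⟩
  else PMF.pure (0, 0)

/-- The offspring law at a site with jump law `p`: with `(a, b)` drawn from `pairLaw p`, an
individual of the first or third type (indices `0`, `2`) has offspring `(a, b, 0)`, one of the
second type (index `1`) has offspring `(a, b, 1)`. -/
noncomputable def offspringLaw (p : StepLaw) (τ : Fin 3) : PMF (Fin 3 → ℕ) :=
  (pairLaw p).map fun v => ![v.1, v.2, if τ = 1 then 1 else 0]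

/-! ### Three-type branching processes with immigration -/

/-- The generations of a three-type branching process with one immigrant of the first type in
each generation, starting from no individuals: `ξ (m, τ, j)` is the offspring of the `j`-th
individual of type `τ` present at time `m` (immigrant included). -/
def generation (ξ : ℕ × Fin 3 × ℕ → Fin 3 → ℕ) : ℕ → Fin 3 → ℕ
  | 0 => 0
  | m + 1 =>
      (∑ j ∈ Finset.range (1 + generation ξ m 0), ξ (m, 0, j))
        + (∑ j ∈ Finset.range (generation ξ m 1), ξ (m, 1, j))
        + ∑ j ∈ Finset.range (generation ξ m 2), ξ (m, 2, j)

/-- The law of the generations `(Z_0, Z_1, …)` when the `ξ (m, τ, j)` are independent and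
`ξ (m, τ, j)` has law `q m τ`. -/
noncomputable def branchingLaw (q : ℕ → Fin 3 → PMF (Fin 3 → ℕ)) :
    Measure (ℕ → Fin 3 → ℕ) :=
  (Measure.infinitePi fun k : ℕ × Fin 3 × ℕ => (q k.1 k.2.1).toMeasure).map generation

theorem measurable_generation : Measurable generation := by
  refine measurable_pi_lambda _ fun m => ?_
  induction m with
  | zero => exact measurable_const
  | succ m ih =>
    have aux : ∀ (τ : Fin 3) (N : (Fin 3 → ℕ) → ℕ),
        Measurable fun ξ : ℕ × Fin 3 × ℕ → Fin 3 → ℕ =>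
          ∑ j ∈ Finset.range (N (generation ξ m)), ξ (m, τ, j) := by
      intro τ N
      have h : Measurable fun z : (ℕ × Fin 3 × ℕ → Fin 3 → ℕ) × (Fin 3 → ℕ) =>
          ∑ j ∈ Finset.range (N z.2), z.1 (m, τ, j) :=
        measurable_from_prod_countable_left fun v =>
          Finset.measurable_sum (Finset.range (N v)) fun j _ =>
            measurable_pi_apply (X := fun _ : ℕ × Fin 3 × ℕ => Fin 3 → ℕ) (m, τ, j)
      exact h.comp (measurable_id.prodMk ih)
    exact ((aux 0 fun v => 1 + v 0).add (aux 1 fun v => v 1)).add (aux 2 fun v => v 2)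

instance isProbabilityMeasure_branchingLaw (q : ℕ → Fin 3 → PMF (Fin 3 → ℕ)) :
    IsProbabilityMeasure (branchingLaw q) :=
  Measure.isProbabilityMeasure_map measurable_generation.aemeasurable

end RWRE

open RWRE

namespace RWRE

/-! ### Decay of the products of mean matrices -/

/-! Finiteness of T_n comes from a potential. With A_k = `meanMatrix (ω k)`, let S_j be the sum over
m of A_j A_{j-1} ⋯ A_{j-m+1} applied to the constant vector 1/ω_{j-m}(1). A negative Lyapunov
exponent provides one length N with E log ‖A_0 ⋯ A_{N-1}‖ < 0. The strong law along disjoint blocks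
of length N to the left of j then gives exponential decay, and integrability of log ω_0(1) controls
the incomplete last block (`ae_tendsto_block_average`, `summable_norm_meanProd`). The first
coordinate h(j) of S_j solves the equation of the mean passage time from j to j + 1
(`exists_potential`). Hence f(x) = ∑_{x ≤ j < n} h(j) is nonnegative and drops by one on average at
each step below n, so the sum over t of the probabilities that n is not hit by time t is at most
f(0), and n is hit almost surely (`ae_exists_hitBy`).

The identity in law compares generating functions. Weight each jump counted in U^n_{i,σ} by u_{i,σ},
and let F_i be the generating function of a passage from i to i + 1. Decomposing at the first step,
F_i = p(1) + (p(-1) u_{i,1} F_{i-1} + p(-2) u_{i,2} u_{i-1,3} F_{i-1} F_{i-2}) F_i with p = ω_i.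
Solving for F_i gives the generating function p(1)/(1 - p(-1)x - p(-2)y) of the offspring pair,
evaluated at x = u_{i,1} F_{i-1}, y = u_{i,2} u_{i-1,3} F_{i-1} F_{i-2}. For the walk, a bounded
martingale yields ∏_{0 ≤ i < n} F_i (`integral_weight_eq`, `integral_prod_pow_jumpCount`); for the
branching process, each immigrant contributes one factor F_i (`integral_prod_pow_branchingLaw`).
Weights of modulus one are characteristic functions, so the laws agree (`ext_of_integral_prod_pow`).

The formula for T_n is pathwise: a jump -1 has total weight 2, a jump -2 has total weight 1 + 2, and
summing 1 = displacement + weight over the steps telescopes (`FirstHit.exists_hasSum`). -/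

theorem measurable_prob (l : ℤ) : Measurable fun p : StepLaw => prob p l := by
  have h : ∀ i : Fin 3, Measurable fun p : StepLaw => p i := fun i =>
    (measurable_pi_apply i).comp measurable_subtype_coe
  unfold prob
  split_ifs
  exacts [h 0, h 1, h 2, measurable_const]

theorem measurable_meanMatrix (i j : Fin 3) : Measurable fun p : StepLaw => meanMatrix p i j := by
  have h0 := (measurable_prob (-1)).div (measurable_prob 1)
  have h1 := (measurable_prob (-2)).div (measurable_prob 1)
  fin_cases i <;> fin_cases j <;>
    first
    | exact h0
    | exact h1
    | exact measurable_const

/-- The product of the mean matrices of the first `N` jump laws of a sequence. -/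
noncomputable def meanProd (N : ℕ) (σ : ℕ → StepLaw) : Matrix (Fin 3) (Fin 3) ℝ :=
  ((List.range N).map fun k => meanMatrix (σ k)).prod

@[simp] theorem meanProd_zero (σ : ℕ → StepLaw) : meanProd 0 σ = 1 := rfl

theorem meanProd_succ (N : ℕ) (σ : ℕ → StepLaw) :
    meanProd (N + 1) σ = meanProd N σ * meanMatrix (σ N) := by
  simp [meanProd, List.range_succ]

theorem meanProd_succ' (N : ℕ) (σ : ℕ → StepLaw) :
    meanProd (N + 1) σ = meanMatrix (σ 0) * meanProd N fun k => σ (k + 1) := by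
  simp [meanProd, List.range_succ_eq_map, Function.comp_def]

theorem meanProd_add (M N : ℕ) (σ : ℕ → StepLaw) :
    meanProd (M + N) σ = meanProd M σ * meanProd N fun k => σ (M + k) := by
  induction N with
  | zero => simp
  | succ N ih => rw [← add_assoc, meanProd_succ, ih, meanProd_succ, mul_assoc]

theorem meanProd_congr {N : ℕ} {σ τ : ℕ → StepLaw} (h : ∀ k < N, σ k = τ k) :
    meanProd N σ = meanProd N τ := by
  unfold meanProd
  congr 1
  exact List.map_congr_left fun k hk => by rw [h k (List.mem_range.1 hk)]

theorem measurable_meanProd {α : Type*} [MeasurableSpace α] {σ : ℕ → α → StepLaw}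
    (hσ : ∀ k, Measurable (σ k)) (N : ℕ) (i j : Fin 3) :
    Measurable fun x => meanProd N (fun k => σ k x) i j := by
  induction N generalizing i j with
  | zero => exact measurable_const
  | succ N ih =>
    simp only [meanProd_succ, Matrix.mul_apply]
    exact Finset.measurable_sum _ fun k _ => (ih i k).mul ((measurable_meanMatrix k j).comp (hσ N))

theorem meanMatrix_nonneg (p : StepLaw) (i j : Fin 3) : 0 ≤ meanMatrix p i j := by
  have h0 := div_nonneg (prob_nonneg p (-1)) (prob_nonneg p 1)
  have h1 := div_nonneg (prob_nonneg p (-2)) (prob_nonneg p 1)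
  fin_cases i <;> fin_cases j <;> simp [meanMatrix, h0, h1]

theorem meanProd_nonneg (N : ℕ) (σ : ℕ → StepLaw) (i j : Fin 3) : 0 ≤ meanProd N σ i j := by
  induction N generalizing i j with
  | zero => rw [meanProd_zero, Matrix.one_apply]; split_ifs <;> norm_num
  | succ N ih =>
    rw [meanProd_succ, Matrix.mul_apply]
    exact Finset.sum_nonneg fun k _ => mul_nonneg (ih i k) (meanMatrix_nonneg _ k j)

/-! ### Norm bounds for products of mean matrices. -/

section Norm

attribute [local instance] Matrix.linftyOpNormedAddCommGroup

theorem measurable_log_norm_meanProd {α : Type*} [MeasurableSpace α] {σ : ℕ → α → StepLaw}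
    (hσ : ∀ k, Measurable (σ k)) (N : ℕ) :
    Measurable fun x => Real.log ‖meanProd N fun k => σ k x‖ := by
  refine Real.measurable_log.comp ?_
  simp only [Matrix.linfty_opNorm_def]
  refine Measurable.coe_nnreal_real ?_
  have h : ∀ i, Measurable fun x => ∑ j, ‖meanProd N (fun k => σ k x) i j‖₊ :=
    fun i => Finset.measurable_sum _ fun j _ => (measurable_meanProd hσ N i j).nnnorm
  have hu : (Finset.univ : Finset (Fin 3)) = {0, 1, 2} := rfl
  rw [hu]
  simp only [Finset.sup_insert, Finset.sup_singleton]
  exact (h 0).sup ((h 1).sup (h 2))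

/-- The largest row sum is that of the second row, a + b + 1, and this equals 1/p(1) because the
three probabilities add up to 1. -/
theorem norm_meanMatrix_le {p : StepLaw} (hp : 0 < prob p 1) : ‖meanMatrix p‖ ≤ (prob p 1)⁻¹ := by
  have h1 := prob_nonneg p (-1)
  have h2 := prob_nonneg p (-2)
  have hs : prob p (-1) / prob p 1 + prob p (-2) / prob p 1 + 1 = (prob p 1)⁻¹ := by
    rw [eq_comm, inv_eq_one_div]
    field_simp
    linarith [prob_sum p]
  rw [Matrix.linfty_opNorm_def, ← NNReal.coe_mk (prob p 1)⁻¹ (by positivity), NNReal.coe_le_coe]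
  refine Finset.sup_le fun i _ => ?_
  rw [← NNReal.coe_le_coe]
  push_cast
  rw [← hs]
  simp only [Fin.sum_univ_three, Real.norm_of_nonneg (meanMatrix_nonneg p i _)]
  fin_cases i <;> simp [meanMatrix]

/-- Controls an incomplete block. Each factor has norm at most 1/p(1), and further factors 1/p(1) ≥
1 fill the block up to length N, so that the bound depends on the whole block only and a strong law
applies to its exponent. -/
theorem norm_meanProd_mul_le {N r : ℕ} {σ : ℕ → StepLaw} (hσ : ∀ k, 0 < prob (σ k) 1)
    (hr : r < N) :
    ‖meanProd r σ‖ * (prob (σ r) 1)⁻¹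
      ≤ Real.exp (∑ i : Fin N, -Real.log (prob (σ i) 1)) := by
  have hle : ∀ k, prob (σ k) 1 ≤ 1 := fun k => by
    linarith [prob_sum (σ k), prob_nonneg (σ k) (-1), prob_nonneg (σ k) (-2)]
  have h1 : ∀ r, ‖meanProd r σ‖ ≤ ∏ i ∈ Finset.range r, (prob (σ i) 1)⁻¹ := by
    intro r
    induction r with
    | zero => simp
    | succ r ih =>
      rw [meanProd_succ, Finset.prod_range_succ]
      exact (Matrix.linfty_opNorm_mul _ _).trans
        (mul_le_mul ih (norm_meanMatrix_le (hσ r)) (norm_nonneg _) ((norm_nonneg _).trans ih))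
  rw [Fin.sum_univ_eq_sum_range fun i => -Real.log (prob (σ i) 1), Real.exp_sum]
  calc _ ≤ ∏ i ∈ Finset.range (r + 1), (prob (σ i) 1)⁻¹ := by
        rw [Finset.prod_range_succ]
        exact mul_le_mul_of_nonneg_right (h1 r) (inv_nonneg.2 (hσ r).le)
    _ ≤ ∏ i ∈ Finset.range N, (prob (σ i) 1)⁻¹ :=
        Finset.prod_le_prod_of_subset_of_one_le (Finset.range_subset_range.2 hr)
          (fun i _ => inv_nonneg.2 (hσ i).le) fun i _ _ => (one_le_inv₀ (hσ i)).2 (hle i)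
    _ = _ := Finset.prod_congr rfl fun i _ => by rw [Real.exp_neg, Real.exp_log (hσ i)]

end Norm

/-- Injectivity of `e` makes the blocks use disjoint sites, hence they are i.i.d. and the strong law
applies to any integrable function of a block. -/
theorem ae_tendsto_block_average (ν : Measure StepLaw) [IsProbabilityMeasure ν] {N : ℕ}
    {e : ℕ × Fin N → ℤ} (he : Function.Injective e) {g : (Fin N → StepLaw) → ℝ}
    (hg : Measurable g) (hint : Integrable g (Measure.infinitePi fun _ => ν)) :
    ∀ᵐ ω ∂envLaw ν, Tendsto
      (fun k : ℕ => (∑ i ∈ Finset.range k, g fun r => ω (e (i, r))) / k) atTop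
      (𝓝 (∫ τ, g τ ∂Measure.infinitePi fun _ => ν)) := by
  have hm : ∀ i : ℕ, Measurable fun (ω : Env) (r : Fin N) => ω (e (i, r)) := fun i => by fun_prop
  have hmap : ∀ i : ℕ, (envLaw ν).map (fun (ω : Env) (r : Fin N) => ω (e (i, r)))
      = Measure.infinitePi fun _ => ν := fun i =>
    Measure.map_infinitePi_infinitePi_of_inj (P := fun _ : ℤ => ν) (f := fun r => e (i, r))
      fun r s h => (Prod.ext_iff.1 (he h)).2
  have hind : iIndepFun (fun (i : ℕ) (ω : Env) (r : Fin N) => ω (e (i, r))) (envLaw ν) := by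
    have : IsProbabilityMeasure (envLaw ν) := by unfold envLaw; infer_instance
    rw [iIndepFun_iff_map_fun_eq_infinitePi_map hm]
    simp_rw [hmap]
    rw [← Measure.infinitePi_map_curry (fun (_ : ℕ) (_ : Fin N) => ν),
      ← Measure.map_infinitePi_infinitePi_of_inj (P := fun _ : ℤ => ν) he,
      Measure.map_map (by fun_prop) (by fun_prop)]
    rfl
  have key := strong_law_ae_real (μ := envLaw ν) (fun i ω => g fun r => ω (e (i, r)))
    (by
      have := hint
      rw [← hmap 0] at this
      exact this.comp_measurable (hm 0))
    (fun i j hij => (hind.indepFun hij).comp hg hg)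
    (fun i => IdentDistrib.comp (u := g)
      ⟨(hm i).aemeasurable, (hm 0).aemeasurable, by rw [hmap, hmap]⟩ hg)
  have hI : ∫ ω, (g fun r => ω (e (0, r))) ∂envLaw ν
      = ∫ τ, g τ ∂Measure.infinitePi fun _ => ν := by
    rw [← hmap 0, integral_map (hm 0).aemeasurable hg.aestronglyMeasurable]
  rw [hI] at key
  exact key

/-! ### Exponential decay along the environment, and the potential. -/

section Decay

attribute [local instance] Matrix.linftyOpNormedAddCommGroup

theorem norm_meanProd_block_le (N k : ℕ) (σ : ℕ → StepLaw) :
    ‖meanProd (N * k) σ‖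
      ≤ Real.exp (∑ i ∈ Finset.range k, Real.log ‖meanProd N fun r => σ (N * i + r)‖) := by
  induction k with
  | zero => simp
  | succ k ih =>
    rw [Nat.mul_succ, meanProd_add, Finset.sum_range_succ, Real.exp_add]
    exact (Matrix.linfty_opNorm_mul _ _).trans
      -- x ≤ exp (log x) also holds at x = 0, where log takes the value 0, so the block products
      -- need not be nonzero.
      (mul_le_mul ih (Real.le_exp_log _) (norm_nonneg _) (Real.exp_nonneg _))

/-- Split the first m factors into k = m / N complete blocks and a remainder. The complete blocks
contribute about exp (γ k), and the remainder at most exp (W k) with W k = o(k) because the averages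
of W converge. -/
theorem summable_norm_meanProd {σ : ℕ → StepLaw} (hσ : ∀ k, 0 < prob (σ k) 1) {N : ℕ}
    (hN : 0 < N) {γ w : ℝ} (hγ : γ < 0)
    (hL : Tendsto (fun k : ℕ => (∑ i ∈ Finset.range k,
      Real.log ‖meanProd N fun r => σ (N * i + r)‖) / k) atTop (𝓝 γ))
    (hW : Tendsto (fun k : ℕ => (∑ i ∈ Finset.range k,
      ∑ r : Fin N, -Real.log (prob (σ (N * i + r)) 1)) / k) atTop (𝓝 w)) :
    Summable fun m => ‖meanProd m σ‖ * (prob (σ m) 1)⁻¹ := by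
  set L : ℕ → ℝ := fun i => Real.log ‖meanProd N fun r => σ (N * i + r)‖
  set W : ℕ → ℝ := fun i => ∑ r : Fin N, -Real.log (prob (σ (N * i + r)) 1)
  -- One more summand does not change the limit of the averages; subtracting `hW` then gives W k / k
  -- → 0.
  have hW1 : Tendsto (fun k : ℕ => (∑ i ∈ Finset.range (k + 1), W i) / k) atTop (𝓝 w) := by
    have h1 := (hW.comp (tendsto_add_atTop_nat 1)).mul
      ((tendsto_natCast_div_add_atTop (1 : ℝ)).inv₀ one_ne_zero)
    simp only [inv_div, inv_one, mul_one] at h1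
    refine h1.congr fun k => ?_
    have : (k : ℝ) + 1 ≠ 0 := by positivity
    simp only [Function.comp_apply, Nat.cast_add, Nat.cast_one]
    rw [div_mul_div_cancel₀ this]
  have hT : Tendsto (fun k : ℕ => ((∑ i ∈ Finset.range k, L i) + W k) / k) atTop (𝓝 γ) := by
    have h2 := hL.add (hW1.sub hW)
    rw [sub_self, add_zero] at h2
    refine h2.congr fun k => ?_
    rw [Finset.sum_range_succ]
    ring
  have hev : ∀ᶠ k : ℕ in atTop, (∑ i ∈ Finset.range k, L i) + W k ≤ γ / 2 * k := by
    filter_upwards [hT.eventually (gt_mem_nhds (show γ < γ / 2 by linarith)),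
      eventually_gt_atTop 0] with k hk hk0
    exact ((div_lt_iff₀ (Nat.cast_pos.2 hk0)).1 hk).le
  have hbound : ∀ m, ‖meanProd m σ‖ * (prob (σ m) 1)⁻¹
      ≤ Real.exp ((∑ i ∈ Finset.range (m / N), L i) + W (m / N)) := by
    intro m
    have hm := Nat.div_add_mod m N
    have h3 := norm_meanProd_mul_le (σ := fun k => σ (N * (m / N) + k)) (fun k => hσ _)
      (Nat.mod_lt m hN)
    rw [hm] at h3
    rw [Real.exp_add]
    calc ‖meanProd m σ‖ * (prob (σ m) 1)⁻¹
        ≤ (‖meanProd (N * (m / N)) σ‖ * ‖meanProd (m % N) fun k => σ (N * (m / N) + k)‖)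
          * (prob (σ m) 1)⁻¹ := by
          refine mul_le_mul_of_nonneg_right ?_ (inv_nonneg.2 (hσ m).le)
          conv_lhs => rw [← hm, meanProd_add]
          exact Matrix.linfty_opNorm_mul _ _
      _ ≤ _ := by
          rw [mul_assoc]
          exact mul_le_mul (norm_meanProd_block_le N _ σ) h3
            (mul_nonneg (norm_nonneg _) (inv_nonneg.2 (hσ m).le)) (Real.exp_nonneg _)
  have hgeo : Summable fun m : ℕ => Real.exp (-(γ / 2)) * Real.exp (γ / 2 / N) ^ m := by
    refine (summable_geometric_of_lt_one (Real.exp_nonneg _) ?_).mul_left _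
    rw [Real.exp_lt_one_iff]
    exact div_neg_of_neg_of_pos (by linarith) (Nat.cast_pos.2 hN)
  refine hgeo.of_norm_bounded_eventually_nat ?_
  filter_upwards [(Nat.tendsto_div_const_atTop hN.ne').eventually hev] with m hm
  rw [Real.norm_of_nonneg (mul_nonneg (norm_nonneg _) (inv_nonneg.2 (hσ m).le))]
  refine ((hbound m).trans (Real.exp_le_exp.2 hm)).trans ?_
  rw [← Real.exp_nat_mul, ← Real.exp_add, Real.exp_le_exp]
  -- Rounding m / N down loses at most 1, which the constant exp (-γ/2) absorbs.
  have h4 : (m : ℝ) / N - 1 ≤ (m / N : ℕ) := by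
    have h5 : (m : ℝ) < N * ((m / N : ℕ) + 1) := by
      exact_mod_cast Nat.lt_mul_div_succ m hN
    have h6 : (m : ℝ) / N < (m / N : ℕ) + 1 := by
      rw [div_lt_iff₀ (Nat.cast_pos.2 hN)]
      linarith
    linarith
  have h7 : (m : ℝ) * (γ / 2 / N) = γ / 2 * (m / N) := by ring
  rw [h7]
  nlinarith

/-- The series S satisfies S_j = 1/p(1) + A_j S_{j-1}, a vector form of the mean passage time
equation; its first coordinate is the potential. -/
theorem exists_potential {ω : Env} (hω : ∀ x, 0 < prob (ω x) 1)
    (hs : ∀ j : ℤ, Summable fun m : ℕ =>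
      ‖meanProd m fun k => ω (j - k)‖ * (prob (ω (j - m)) 1)⁻¹) :
    ∃ h : ℤ → ℝ, (∀ j, 0 ≤ h j) ∧ ∀ j, prob (ω j) 1 * h j
      = 1 + (prob (ω j) (-1) + prob (ω j) (-2)) * h (j - 1) + prob (ω j) (-2) * h (j - 2) := by
  set v : ℕ → ℤ → Fin 3 → ℝ := fun m j =>
    (meanProd m fun k => ω (j - k)).mulVec fun _ => (prob (ω (j - m)) 1)⁻¹ with hv
  have hvs : ∀ j, Summable fun m => v m j := fun j => by
    refine Summable.of_norm_bounded (hs j) fun m => ?_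
    refine (Matrix.linfty_opNorm_mulVec _ _).trans (mul_le_mul_of_nonneg_left ?_ (norm_nonneg _))
    rw [pi_norm_const, Real.norm_of_nonneg (inv_nonneg.2 (hω _).le)]
  have hv0 : ∀ j, v 0 j = fun _ => (prob (ω j) 1)⁻¹ := fun j => by simp [hv]
  have hvsucc : ∀ m j, v (m + 1) j = (meanMatrix (ω j)).mulVec (v m (j - 1)) := fun m j => by
    simp only [hv, meanProd_succ', Matrix.mulVec_mulVec]
    push_cast
    simp only [sub_zero, sub_add_eq_sub_sub, sub_right_comm j _ (1 : ℤ)]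
  set S : ℤ → Fin 3 → ℝ := fun j => ∑' m, v m j with hS
  have hrec : ∀ j, S j = (fun _ => (prob (ω j) 1)⁻¹) + (meanMatrix (ω j)).mulVec (S (j - 1)) := by
    intro j
    have h1 := (hvs j).tsum_eq_zero_add
    have h2 := ((hvs (j - 1)).hasSum.map (Matrix.mulVecLin (meanMatrix (ω j)))
      (LinearMap.continuous_of_finiteDimensional _)).tsum_eq
    simp only [Function.comp_def, Matrix.mulVecLin_apply, ← hvsucc] at h2
    rw [hS]
    simp only
    rw [h1, hv0, h2]
  have hnn : ∀ j i, 0 ≤ S j i := fun j i => by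
    have : S j i = ∑' m, v m j i := tsum_apply (hvs j)
    rw [this]
    refine tsum_nonneg fun m => ?_
    change 0 ≤ ∑ l, (meanProd m fun k => ω (j - k)) i l * (prob (ω (j - m)) 1)⁻¹
    refine Finset.sum_nonneg fun l _ => ?_
    exact mul_nonneg (meanProd_nonneg _ _ _ _) (inv_nonneg.2 (hω _).le)
  have e0 : ∀ j, S j 0 = (prob (ω j) 1)⁻¹ + (prob (ω j) (-1) / prob (ω j) 1 * S (j - 1) 0
      + prob (ω j) (-2) / prob (ω j) 1 * S (j - 1) 1) := fun j => by
    conv_lhs => rw [hrec j]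
    simp [dotProduct, Fin.sum_univ_three, meanMatrix]
  have e1 : ∀ j, S j 1 = (prob (ω j) 1)⁻¹ + (prob (ω j) (-1) / prob (ω j) 1 * S (j - 1) 0
      + prob (ω j) (-2) / prob (ω j) 1 * S (j - 1) 1 + S (j - 1) 2) := fun j => by
    conv_lhs => rw [hrec j]
    simp [dotProduct, Fin.sum_univ_three, meanMatrix]
  have e2 : ∀ j, S j 2 = (prob (ω j) 1)⁻¹ + (prob (ω j) (-1) / prob (ω j) 1 * S (j - 1) 0
      + prob (ω j) (-2) / prob (ω j) 1 * S (j - 1) 1) := fun j => by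
    conv_lhs => rw [hrec j]
    simp [dotProduct, Fin.sum_univ_three, meanMatrix]
  refine ⟨fun j => S j 0, fun j => hnn j 0, fun j => ?_⟩
  -- The second row of A exceeds the two others by a single entry 1, and the first and third
  -- coordinates of S coincide. This eliminates the second coordinate and leaves a scalar recursion.
  have h3 : S (j - 1) 1 = S (j - 1) 0 + S (j - 2) 0 := by
    rw [e1 (j - 1), e0 (j - 1), show j - 1 - 1 = j - 2 by ring, e0 (j - 2), e2 (j - 2)]
    ring
  simp only
  rw [e0 j, h3]
  have := (hω j).ne'
  field_simp
  ring

end Decay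

theorem ae_prob_pos (ν : Measure StepLaw) [IsProbabilityMeasure ν] {l : ℤ}
    (h : ∀ᵐ p ∂ν, 0 < prob p l) : ∀ᵐ ω ∂envLaw ν, ∀ x : ℤ, 0 < prob (ω x) l := by
  refine ae_all_iff.2 fun x => ?_
  exact (measurePreserving_eval_infinitePi (fun _ : ℤ => ν) x).quasiMeasurePreserving.ae h

theorem ae_exists_potential (ν : Measure StepLaw) [IsProbabilityMeasure ν]
    (hpos : ∀ᵐ p ∂ν, 0 < prob p 1) (hint : Integrable (fun p => Real.log (prob p 1)) ν)
    (hγ : topLyapunov ν < 0) :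
    ∀ᵐ ω ∂envLaw ν, ∃ h : ℤ → ℝ, (∀ j, 0 ≤ h j) ∧ ∀ j, prob (ω j) 1 * h j
      = 1 + (prob (ω j) (-1) + prob (ω j) (-2)) * h (j - 1) + prob (ω j) (-2) * h (j - 2) := by
  let _ : NormedAddCommGroup (Matrix (Fin 3) (Fin 3) ℝ) := Matrix.linftyOpNormedAddCommGroup
  -- A negative limsup gives one block length with a negative mean; nothing else about the exponent
  -- is needed.
  obtain ⟨N, hNγ, hN⟩ := ((eventually_lt_of_limsup_lt hγ).and (eventually_gt_atTop 0)).exists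
  obtain ⟨M, rfl⟩ : ∃ M, N = M + 1 := ⟨N - 1, by omega⟩
  have hneg : ∫ ω, Real.log ‖meanProd (M + 1) fun k => ω (k : ℤ)‖ ∂envLaw ν < 0 := by
    have h1 : (∫ ω, Real.log ‖meanProd (M + 1) fun k => ω (k : ℤ)‖ ∂envLaw ν) / (M + 1 : ℕ) < 0 := by
      have h0 := EReal.coe_lt_coe_iff.1 (hNγ.trans_eq EReal.coe_zero.symm)
      convert h0 using 8
      -- In `topLyapunov` the cast to ℤ is applied monadically to the whole list of indices; it is
      -- turned back into a map.
      rw [List.bind_eq_flatMap, show (List.range (M + 1)).flatMap (fun a : ℕ => pure (a : ℤ))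
        = (List.range (M + 1)).map (fun a : ℕ => (a : ℤ)) from List.flatMap_pure_eq_map _ _,
        List.map_map]
      rfl
    by_contra h2
    exact absurd h1 (not_lt.2 (div_nonneg (not_lt.1 h2) (Nat.cast_nonneg _)))
  set g : (Fin (M + 1) → StepLaw) → ℝ := fun τ =>
    Real.log ‖meanProd (M + 1) fun k => τ (Fin.ofNat (M + 1) k)‖ with hg
  have hgm : Measurable g :=
    measurable_log_norm_meanProd (fun k => measurable_pi_apply (Fin.ofNat (M + 1) k)) _
  have hgω : ∀ σ : ℕ → StepLaw, (g fun r => σ r) = Real.log ‖meanProd (M + 1) σ‖ := fun σ => by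
    simp only [hg]
    congr 2
    refine meanProd_congr fun k hk => ?_
    simp [Fin.ofNat, Nat.mod_eq_of_lt hk]
  set P : Measure (Fin (M + 1) → StepLaw) := Measure.infinitePi fun _ => ν
  have hmap : (envLaw ν).map (fun (ω : Env) (r : Fin (M + 1)) => ω ((r : ℕ) : ℤ)) = P :=
    Measure.map_infinitePi_infinitePi_of_inj (P := fun _ : ℤ => ν)
      (f := fun r : Fin (M + 1) => ((r : ℕ) : ℤ)) fun r s h => Fin.ext (Int.ofNat_inj.1 h)
  have hreind : Measurable fun (ω : Env) (r : Fin (M + 1)) => ω ((r : ℕ) : ℤ) :=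
    measurable_pi_lambda _ fun r => measurable_pi_apply _
  have hgI : ∫ τ, g τ ∂P < 0 := by
    rw [← hmap, integral_map hreind.aemeasurable hgm.aestronglyMeasurable]
    refine lt_of_eq_of_lt (integral_congr_ae (ae_of_all _ fun ω => ?_)) hneg
    exact hgω fun k => ω (k : ℤ)
  -- A nonintegrable function has integral 0 by convention, so a negative integral forces
  -- integrability.
  have hgint : Integrable g P := by
    by_contra h
    rw [integral_undef h] at hgI
    exact lt_irrefl _ hgI
  set f : (Fin (M + 1) → StepLaw) → ℝ := fun τ => ∑ r, -Real.log (prob (τ r) 1) with hf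
  have hfm : Measurable f := Finset.measurable_sum _ fun r _ =>
    (Real.measurable_log.comp ((measurable_prob 1).comp (measurable_pi_apply r))).neg
  have hfint : Integrable f P := by
    refine integrable_finsetSum _ fun r _ => Integrable.neg ?_
    exact (measurePreserving_eval_infinitePi (fun _ : Fin (M + 1) => ν) r).integrable_comp_of_integrable
      hint
  have key : ∀ j : ℤ, ∀ᵐ ω ∂envLaw ν, (∀ x, 0 < prob (ω x) 1) →
      Summable fun m : ℕ => ‖meanProd m fun k => ω (j - k)‖ * (prob (ω (j - m)) 1)⁻¹ := by
    intro j
    -- The blocks run leftwards from j, whereas `topLyapunov` reads the sites to the right of 0; the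
    -- environment is i.i.d., so the law of a block is the same.
    have he : Function.Injective fun q : ℕ × Fin (M + 1) =>
        j - (((M + 1) * q.1 + q.2 : ℕ) : ℤ) := by
      rintro ⟨k, r⟩ ⟨l, s⟩ h
      have h' : (M + 1) * k + r = (M + 1) * l + s := by
        simp only [sub_right_inj] at h
        exact_mod_cast h
      have hk := congrArg (· / (M + 1)) h'
      simp only [Nat.mul_add_div (Nat.succ_pos M), Nat.div_eq_of_lt r.2, Nat.div_eq_of_lt s.2,
        add_zero] at hk
      subst hk
      exact Prod.ext rfl (Fin.ext (by simpa using h'))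
    filter_upwards [ae_tendsto_block_average ν he hgm hgint,
      ae_tendsto_block_average ν he hfm hfint] with ω h1 h2 hω
    refine summable_norm_meanProd (σ := fun k => ω (j - k)) (fun k => hω _) hN hgI (w := ∫ τ, f τ ∂P)
      ?_ ?_
    · refine h1.congr fun k => ?_
      congr 1
      exact Finset.sum_congr rfl fun i _ => hgω fun r => ω (j - ((M + 1) * i + r : ℕ))
    · exact h2
  filter_upwards [ae_all_iff.2 key, ae_prob_pos ν hpos] with ω h1 h2
  exact exists_potential h2 fun j => h1 j h2

/-! ### One step of the walk -/

instance isProbabilityMeasure_quenchedLaw (ω : Env) : IsProbabilityMeasure (quenchedLaw ω) := by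
  unfold quenchedLaw
  infer_instance

/-- A finite path, continued by its last position. -/
def stopPath (t : ℕ) (y : (i : Finset.Iic t) → (fun _ : ℕ => ℤ) i) (s : ℕ) : ℤ :=
  y ⟨min s t, Finset.mem_Iic.2 (min_le_right s t)⟩

theorem stopPath_frestrictLe (t : ℕ) (X : ℕ → ℤ) :
    stopPath t (Preorder.frestrictLe t X) = fun s => X (min s t) := rfl

/-- A function of the path up to time t factors through a countable discrete space, so it is
measurable whatever its definition. -/
theorem measurable_of_past {E : Type*} [MeasurableSpace E] {F : (ℕ → ℤ) → E} {t : ℕ}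
    (hF : ∀ X, F (fun s => X (min s t)) = F X) : Measurable F := by
  have : F = (fun y => F (stopPath t y)) ∘ Preorder.frestrictLe (π := fun _ : ℕ => ℤ) t := by
    funext X
    rw [Function.comp_apply, stopPath_frestrictLe, hF]
  rw [this]
  exact (measurable_of_countable _).comp (Preorder.measurable_frestrictLe t)

theorem map_quenchedLaw_frestrictLe (ω : Env) (t : ℕ) :
    (quenchedLaw ω).map (fun X => (Preorder.frestrictLe (π := fun _ : ℕ => ℤ) t X, X (t + 1)))
      = ((quenchedLaw ω).map (Preorder.frestrictLe (π := fun _ : ℕ => ℤ) t)) ⊗ₘ stepKernel ω t := by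
  unfold quenchedLaw
  rw [Kernel.traj_map_frestrictLe_apply, Kernel.partialTraj_compProd_eq_map_traj (Nat.zero_le t)]

theorem lintegral_stepMeasure (ω : Env) (x : ℤ) (g : ℤ → ENNReal) :
    ∫⁻ z, g z ∂stepMeasure ω x = ENNReal.ofReal (prob (ω x) (-2)) * g (x - 2)
      + ENNReal.ofReal (prob (ω x) (-1)) * g (x - 1) + ENNReal.ofReal (prob (ω x) 1) * g (x + 1) := by
  simp [stepMeasure, lintegral_add_measure, lintegral_smul_measure]

theorem integral_stepMeasure (ω : Env) (x : ℤ) (g : ℤ → ℂ) :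
    ∫ z, g z ∂stepMeasure ω x = prob (ω x) (-2) * g (x - 2)
      + prob (ω x) (-1) * g (x - 1) + prob (ω x) 1 * g (x + 1) := by
  have hi : ∀ (c : ℝ) (y : ℤ), Integrable g (ENNReal.ofReal c • Measure.dirac y) := fun c y =>
    (integrable_dirac (by simp)).smul_measure ENNReal.ofReal_ne_top
  unfold stepMeasure
  rw [integral_add_measure ((hi _ _).add_measure (hi _ _)) (hi _ _),
    integral_add_measure (hi _ _) (hi _ _)]
  simp [integral_smul_measure, integral_dirac, prob_nonneg]

/-- The Markov property: by `hF` the functional sees the path only up to time t, so the next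
position can be integrated out given the history. -/
theorem lintegral_quenchedLaw_succ (ω : Env) {t : ℕ} {F : (ℕ → ℤ) → ℤ → ENNReal}
    (hF : ∀ X, F (fun s => X (min s t)) = F X) :
    ∫⁻ X, F X (X (t + 1)) ∂quenchedLaw ω
      = ∫⁻ X, (ENNReal.ofReal (prob (ω (X t)) (-2)) * F X (X t - 2)
        + ENNReal.ofReal (prob (ω (X t)) (-1)) * F X (X t - 1)
        + ENNReal.ofReal (prob (ω (X t)) 1) * F X (X t + 1)) ∂quenchedLaw ω := by
  obtain ⟨K, hK⟩ : ∃ K : ((i : Finset.Iic t) → (fun _ : ℕ => ℤ) i) × ℤ → ENNReal,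
      ∀ q, K q = F (stopPath t q.1) q.2 := ⟨_, fun _ => rfl⟩
  have h1 : ∀ X, F X (X (t + 1))
      = K (Preorder.frestrictLe (π := fun _ : ℕ => ℤ) t X, X (t + 1)) :=
    fun X => by simp only [hK, stopPath_frestrictLe, hF]
  simp_rw [h1]
  rw [← lintegral_map (measurable_of_countable _) (by fun_prop), map_quenchedLaw_frestrictLe,
    Measure.lintegral_compProd (measurable_of_countable _),
    lintegral_map (measurable_of_countable _) (by fun_prop)]
  refine lintegral_congr fun X => ?_
  simp only [hK]
  change ∫⁻ z, F (stopPath t (Preorder.frestrictLe t X)) z ∂stepMeasure ω (X t) = _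
  rw [lintegral_stepMeasure, stopPath_frestrictLe, hF]

theorem integral_quenchedLaw_succ (ω : Env) {t : ℕ} {F : (ℕ → ℤ) → ℤ → ℂ}
    (hF : ∀ X, F (fun s => X (min s t)) = F X) {C : ℝ} (hC : ∀ X z, ‖F X z‖ ≤ C) :
    ∫ X, F X (X (t + 1)) ∂quenchedLaw ω
      = ∫ X, (prob (ω (X t)) (-2) * F X (X t - 2) + prob (ω (X t)) (-1) * F X (X t - 1)
        + prob (ω (X t)) 1 * F X (X t + 1)) ∂quenchedLaw ω := by
  obtain ⟨K, hK⟩ : ∃ K : ((i : Finset.Iic t) → (fun _ : ℕ => ℤ) i) × ℤ → ℂ,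
      ∀ q, K q = F (stopPath t q.1) q.2 := ⟨_, fun _ => rfl⟩
  have h1 : ∀ X, F X (X (t + 1))
      = K (Preorder.frestrictLe (π := fun _ : ℕ => ℤ) t X, X (t + 1)) :=
    fun X => by simp only [hK, stopPath_frestrictLe, hF]
  have hm : Measurable K := measurable_of_countable _
  simp_rw [h1]
  have : IsProbabilityMeasure
      ((quenchedLaw ω).map (Preorder.frestrictLe (π := fun _ : ℕ => ℤ) t)) :=
    Measure.isProbabilityMeasure_map (by fun_prop)
  rw [← integral_map (by fun_prop) hm.aestronglyMeasurable, map_quenchedLaw_frestrictLe,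
    Measure.integral_compProd (Integrable.of_bound hm.aestronglyMeasurable C
      (ae_of_all _ fun q => by rw [hK]; exact hC _ _)),
    integral_map (by fun_prop) (measurable_of_countable _).aestronglyMeasurable]
  refine integral_congr_ae (ae_of_all _ fun X => ?_)
  simp only [hK]
  change ∫ z, F (stopPath t (Preorder.frestrictLe t X)) z ∂stepMeasure ω (X t) = _
  rw [integral_stepMeasure, stopPath_frestrictLe, hF]

/-- The paths that the walk can follow. -/
def IsWalk (X : ℕ → ℤ) : Prop :=
  X 0 = 0 ∧ ∀ t, X (t + 1) = X t - 2 ∨ X (t + 1) = X t - 1 ∨ X (t + 1) = X t + 1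

theorem ae_isWalk (ω : Env) : ∀ᵐ X ∂quenchedLaw ω, IsWalk X := by
  refine Filter.Eventually.and ?_ (ae_all_iff.2 fun t => ?_)
  · have h : (quenchedLaw ω).map (Preorder.frestrictLe (π := fun _ : ℕ => ℤ) 0)
        = Measure.dirac fun _ => 0 := by
      unfold quenchedLaw
      rw [Kernel.traj_map_frestrictLe_apply, Kernel.partialTraj_self, Kernel.id_apply]
    have h2 : ∀ᵐ y ∂(quenchedLaw ω).map (Preorder.frestrictLe (π := fun _ : ℕ => ℤ) 0),
        y ⟨0, Finset.mem_Iic.2 le_rfl⟩ = 0 := by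
      rw [h, ae_dirac_eq]
      rfl
    exact ae_of_ae_map (by fun_prop) h2
  -- The one-step formula is applied to the indicator of a forbidden step, which vanishes at the
  -- three possible positions.
  · have h := lintegral_quenchedLaw_succ ω (t := t)
      (F := fun X z => if z = X t - 2 ∨ z = X t - 1 ∨ z = X t + 1 then 0 else 1)
      (fun X => by simp)
    simp only [true_or, or_true, if_true, mul_zero, add_zero, lintegral_zero] at h
    have hm : Measurable fun X : ℕ → ℤ =>
        if X (t + 1) = X t - 2 ∨ X (t + 1) = X t - 1 ∨ X (t + 1) = X t + 1 then (0 : ENNReal)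
        else 1 := measurable_of_past (t := t + 1) fun X => by simp
    rw [lintegral_eq_zero_iff hm] at h
    filter_upwards [h] with X hX
    by_contra hc
    simp [hc] at hX

/-! ### Hitting a level -/

/-- The path is at `n` at some positive time up to `t`. -/
def HitBy (n : ℤ) (t : ℕ) (X : ℕ → ℤ) : Prop := ∃ s, 0 < s ∧ s ≤ t ∧ X s = n

theorem HitBy.mono {n : ℤ} {s t : ℕ} {X : ℕ → ℤ} (h : HitBy n s X) (hst : s ≤ t) : HitBy n t X := by
  obtain ⟨r, h0, h1, h2⟩ := h
  exact ⟨r, h0, h1.trans hst, h2⟩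

theorem hitBy_succ {n : ℤ} {t : ℕ} {X : ℕ → ℤ} :
    HitBy n (t + 1) X ↔ HitBy n t X ∨ X (t + 1) = n := by
  constructor
  · rintro ⟨s, h0, h1, h2⟩
    rcases Nat.le_succ_iff.1 h1 with h | rfl
    · exact Or.inl ⟨s, h0, h, h2⟩
    · exact Or.inr h2
  · rintro (h | h)
    · exact h.mono (Nat.le_succ t)
    · exact ⟨t + 1, Nat.succ_pos t, le_rfl, h⟩

theorem hitBy_min {n : ℤ} {k t : ℕ} (hk : k ≤ t) (X : ℕ → ℤ) :
    HitBy n k (fun s => X (min s t)) ↔ HitBy n k X := by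
  refine exists_congr fun s => and_congr_right fun _ => and_congr_right fun hs => ?_
  simp only [min_eq_left (hs.trans hk)]

/-- Upward jumps have size one, so the walk cannot pass n without visiting it. -/
theorem IsWalk.lt_of_not_hitBy {X : ℕ → ℤ} (hX : IsWalk X) {n : ℤ} (hn : 0 < n) {t : ℕ}
    (h : ¬ HitBy n t X) : X t < n := by
  induction t with
  | zero => rwa [hX.1]
  | succ t ih =>
    rw [hitBy_succ, not_or] at h
    have h1 := ih h.1
    have h2 := h.2
    rcases hX.2 t with h3 | h3 | h3 <;> omega

/-- `T` is the first positive time at which the path is at `n`. -/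
def FirstHit (n : ℤ) (T : ℕ) (X : ℕ → ℤ) : Prop :=
  0 < T ∧ X T = n ∧ ∀ s, 0 < s → s < T → X s ≠ n

theorem exists_firstHit {n : ℤ} {X : ℕ → ℤ} (h : ∃ t, HitBy n t X) : ∃ T, FirstHit n T X := by
  classical
  have hex : ∃ T, 0 < T ∧ X T = n := by
    obtain ⟨t, s, h0, -, h2⟩ := h
    exact ⟨s, h0, h2⟩
  exact ⟨Nat.find hex, (Nat.find_spec hex).1, (Nat.find_spec hex).2,
    fun s h0 hs h2 => Nat.find_min hex hs ⟨h0, h2⟩⟩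

theorem FirstHit.hitBy_iff {n : ℤ} {T : ℕ} {X : ℕ → ℤ} (h : FirstHit n T X) (k : ℕ) :
    HitBy n k X ↔ T ≤ k := by
  constructor
  · rintro ⟨s, h0, h1, h2⟩
    by_contra hc
    exact h.2.2 s h0 (by omega) h2
  · exact fun hk => ⟨T, h.1, hk, h.2.1⟩

theorem FirstHit.lt {n : ℤ} (hn : 0 < n) {T : ℕ} {X : ℕ → ℤ} (h : FirstHit n T X) (hX : IsWalk X)
    {k : ℕ} (hk : k < T) : X k < n :=
  hX.lt_of_not_hitBy hn (by rw [h.hitBy_iff]; omega)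

open Classical in
-- A drift argument: f decreases on average by one at each step made below n, so a nonnegative f can
-- pay for only finitely many such steps in expectation.
theorem ae_exists_hitBy {ω : Env} {h : ℤ → ℝ} (h0 : ∀ j, 0 ≤ h j)
    (hh : ∀ j, prob (ω j) 1 * h j
      = 1 + (prob (ω j) (-1) + prob (ω j) (-2)) * h (j - 1) + prob (ω j) (-2) * h (j - 2))
    {n : ℤ} (hn : 0 < n) : ∀ᵐ X ∂quenchedLaw ω, ∃ t, HitBy n t X := by
  set f : ℤ → ℝ := fun x => ∑ j ∈ Finset.Ico x n, h j with hf
  have hf0 : ∀ x, 0 ≤ f x := fun x => Finset.sum_nonneg fun j _ => h0 j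
  have hfs : ∀ x < n, f x = h x + f (x + 1) := fun x hx => by
    simp only [hf]
    rw [← Finset.insert_Ico_add_one_left_eq_Ico hx, Finset.sum_insert (by simp)]
  have hstep : ∀ x < n, ENNReal.ofReal (f x) = 1 + (ENNReal.ofReal (prob (ω x) (-2)) *
      ENNReal.ofReal (f (x - 2)) + ENNReal.ofReal (prob (ω x) (-1)) * ENNReal.ofReal (f (x - 1))
      + ENNReal.ofReal (prob (ω x) 1) * ENNReal.ofReal (f (x + 1))) := fun x hx => by
    have p1 := prob_nonneg (ω x) 1
    have p2 := prob_nonneg (ω x) (-1)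
    have p3 := prob_nonneg (ω x) (-2)
    have m1 := mul_nonneg p1 (hf0 (x + 1))
    have m2 := mul_nonneg p2 (hf0 (x - 1))
    have m3 := mul_nonneg p3 (hf0 (x - 2))
    rw [← ENNReal.ofReal_mul p1, ← ENNReal.ofReal_mul p2, ← ENNReal.ofReal_mul p3,
      ← ENNReal.ofReal_add m3 m2, ← ENNReal.ofReal_add (add_nonneg m3 m2) m1,
      ← ENNReal.ofReal_one, ← ENNReal.ofReal_add zero_le_one (add_nonneg (add_nonneg m3 m2) m1)]
    congr 1
    have e1 := hfs x hx
    have e2 := hfs (x - 1) (by omega)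
    have e3 := hfs (x - 2) (by omega)
    rw [sub_add_cancel] at e2
    rw [show x - 2 + 1 = x - 1 by ring] at e3
    rw [e3, e2]
    have e4 : f (x + 1) = f x - h x := by linarith
    rw [e4]
    linear_combination (-(f x)) * prob_sum (ω x) + hh x
  set D : ℕ → ENNReal := fun t => ∫⁻ X, (if HitBy n t X then 0 else ENNReal.ofReal (f (X t)))
    ∂quenchedLaw ω with hD
  have hmeas : ∀ t, MeasurableSet {X : ℕ → ℤ | ¬ HitBy n t X} := fun t =>
    measurableSet_setOfPred.2 (measurable_of_past (t := t) fun X => by rw [hitBy_min le_rfl])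
  -- An inequality suffices: paths that reach n at time t + 1 have a zero integrand on the left. The
  -- added probability is the unit drop of f on the paths that have not hit n by time t.
  have hDs : ∀ t, D (t + 1) + quenchedLaw ω {X | ¬ HitBy n t X} ≤ D t := by
    intro t
    have hF := lintegral_quenchedLaw_succ ω (t := t)
      (F := fun X z => if HitBy n t X then 0 else ENNReal.ofReal (f z))
      (fun X => by simp only [hitBy_min le_rfl])
    calc D (t + 1) + quenchedLaw ω {X | ¬ HitBy n t X}
        ≤ (∫⁻ X, (if HitBy n t X then 0 else ENNReal.ofReal (f (X (t + 1)))) ∂quenchedLaw ω)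
          + ∫⁻ X, (if HitBy n t X then 0 else 1) ∂quenchedLaw ω := by
          refine add_le_add (lintegral_mono fun X => ?_) (le_of_eq ?_)
          · by_cases h1 : HitBy n t X
            · simp [h1, h1.mono (Nat.le_succ t)]
            · simp only [h1, if_false]
              split_ifs <;> simp
          · rw [← lintegral_indicator_one (hmeas t)]
            refine lintegral_congr fun X => ?_
            by_cases h1 : HitBy n t X <;> simp [Set.indicator, h1]
      _ = D t := by
          rw [hF, ← lintegral_add_right _
            (measurable_of_past (t := t) fun X => by simp only [hitBy_min le_rfl])]
          refine lintegral_congr_ae ?_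
          filter_upwards [ae_isWalk ω] with X hX
          by_cases h1 : HitBy n t X
          · simp [h1]
          · simp only [h1, if_false]
            rw [hstep _ (hX.lt_of_not_hitBy hn h1), add_comm]
  have hDsum : ∀ t, D t + ∑ s ∈ Finset.range t, quenchedLaw ω {X | ¬ HitBy n s X} ≤ D 0 := by
    intro t
    induction t with
    | zero => simp
    | succ t ih =>
      rw [Finset.sum_range_succ, add_comm (∑ _ ∈ _, _), ← add_assoc]
      exact (add_le_add (hDs t) le_rfl).trans ih
  have hD0 : D 0 ≠ ⊤ := by
    refine ne_top_of_le_ne_top (ENNReal.ofReal_ne_top (r := f 0)) ?_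
    calc D 0 ≤ ∫⁻ _, ENNReal.ofReal (f 0) ∂quenchedLaw ω := by
          refine lintegral_mono_ae ?_
          filter_upwards [ae_isWalk ω] with X hX
          rw [hX.1]
          split_ifs <;> simp
      _ = ENNReal.ofReal (f 0) := by simp
  rw [ae_iff]
  simp only [not_exists]
  set B := {X : ℕ → ℤ | ∀ t, ¬ HitBy n t X}
  -- Paths that never hit n lie in each of the first t events, so t times their probability stays
  -- below the finite number D 0.
  have hB : ∀ t : ℕ, (t : ENNReal) * quenchedLaw ω B ≤ D 0 := fun t => by
    refine le_trans ?_ (hDsum t)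
    refine le_trans ?_ le_add_self
    rw [← nsmul_eq_mul, ← Finset.card_range t, ← Finset.sum_const]
    simp only [Finset.card_range]
    exact Finset.sum_le_sum fun s _ => measure_mono fun X hX => hX s
  by_contra hne
  obtain ⟨t, ht⟩ := ENNReal.exists_nat_gt (ENNReal.div_ne_top hD0 hne)
  refine absurd (hB t) (not_le.2 ?_)
  rwa [ENNReal.div_lt_iff (Or.inl hne) (Or.inl (measure_ne_top _ _))] at ht

/-! ### Multiplicative functionals of the walk up to the hitting time -/

open Classical in
-- The product of the weights so far, times V at the current position and frozen once n is hit, is a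
-- martingale bounded by 1. It starts at V 0 and, as V n = 1, ends at the full product of weights.
theorem integral_weight_eq {ω : Env} {n : ℤ} (hn : 0 < n)
    (hhit : ∀ᵐ X ∂quenchedLaw ω, ∃ t, HitBy n t X) {w : ℤ → ℤ → ℂ} (hw : ∀ x y, ‖w x y‖ ≤ 1)
    {V : ℤ → ℂ} (hV : ∀ x, ‖V x‖ ≤ 1) (hVn : V n = 1)
    (hharm : ∀ x < n, V x = prob (ω x) (-2) * (w x (x - 2) * V (x - 2))
      + prob (ω x) (-1) * (w x (x - 1) * V (x - 1)) + prob (ω x) 1 * (w x (x + 1) * V (x + 1)))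
    {G : (ℕ → ℤ) → ℂ}
    (hG : ∀ X, IsWalk X → ∀ T, FirstHit n T X →
      G X = ∏ k ∈ Finset.range T, w (X k) (X (k + 1))) :
    ∫ X, G X ∂quenchedLaw ω = V 0 := by
  set Q : ℕ → (ℕ → ℤ) → ℂ := fun t X =>
    ∏ k ∈ Finset.range t, if HitBy n k X then 1 else w (X k) (X (k + 1)) with hQ
  have hQn : ∀ t X, ‖Q t X‖ ≤ 1 := fun t X => by
    rw [hQ, norm_prod]
    refine Finset.prod_le_one (fun _ _ => norm_nonneg _) fun k _ => ?_
    split_ifs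
    · simp
    · exact hw _ _
  have hQp : ∀ t X, Q t (fun s => X (min s t)) = Q t X := fun t X => by
    refine Finset.prod_congr rfl fun k hk => ?_
    have hk' := Finset.mem_range.1 hk
    simp only [hitBy_min hk'.le, min_eq_left hk'.le, min_eq_left (Nat.succ_le_of_lt hk')]
  set M : ℕ → (ℕ → ℤ) → ℂ := fun t X => Q t X * if HitBy n t X then 1 else V (X t) with hM
  have hMn : ∀ t X, ‖M t X‖ ≤ 1 := fun t X => by
    rw [hM, norm_mul]
    refine mul_le_one₀ (hQn t X) (norm_nonneg _) ?_
    split_ifs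
    · simp
    · exact hV _
  have hMm : ∀ t, Measurable (M t) := fun t => measurable_of_past (t := t) fun X => by
    simp only [hM, hQp, hitBy_min le_rfl, min_self]
  have hstep : ∀ t, ∫ X, M (t + 1) X ∂quenchedLaw ω = ∫ X, M t X ∂quenchedLaw ω := by
    intro t
    -- When n is first hit at time t + 1, the frozen value 1 agrees with V n, so one formula covers
    -- this case and that of no hit.
    have h1 : ∀ X, M (t + 1) X
        = Q t X * if HitBy n t X then 1 else w (X t) (X (t + 1)) * V (X (t + 1)) := by
      intro X
      simp only [hM, hQ, Finset.prod_range_succ, mul_assoc]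
      congr 1
      by_cases h : HitBy n t X
      · simp [h, h.mono (Nat.le_succ t)]
      · by_cases h2 : X (t + 1) = n
        · simp [h, hitBy_succ, h2, hVn]
        · simp [h, hitBy_succ, h2]
    simp_rw [h1]
    rw [integral_quenchedLaw_succ ω (t := t) (C := 1)
      (F := fun X z => Q t X * if HitBy n t X then 1 else w (X t) z * V z)
      (fun X => by simp only [hQp, hitBy_min le_rfl, min_self])
      (fun X z => by
        rw [norm_mul]
        refine mul_le_one₀ (hQn t X) (norm_nonneg _) ?_
        split_ifs
        · simp
        · rw [norm_mul]
          exact mul_le_one₀ (hw _ _) (norm_nonneg _) (hV _))]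
    refine integral_congr_ae ?_
    filter_upwards [ae_isWalk ω] with X hX
    simp only [hM]
    by_cases h : HitBy n t X
    · simp only [h, if_true]
      have hs : (prob (ω (X t)) (-2) : ℂ) + prob (ω (X t)) (-1) + prob (ω (X t)) 1 = 1 := by
        exact_mod_cast prob_sum (ω (X t))
      linear_combination Q t X * hs
    · simp only [h, if_false]
      rw [hharm _ (hX.lt_of_not_hitBy hn h)]
      ring
  have hconst : ∀ t, ∫ X, M t X ∂quenchedLaw ω = V 0 := by
    intro t
    induction t with
    | zero =>
      have : ∀ᵐ X ∂quenchedLaw ω, M 0 X = V 0 := by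
        filter_upwards [ae_isWalk ω] with X hX
        have : ¬ HitBy n 0 X := by rintro ⟨s, h0, h1, -⟩; omega
        simp [hM, hQ, this, hX.1]
      rw [integral_congr_ae this]
      simp
    | succ t ih => rw [hstep, ih]
  have hlim : ∀ᵐ X ∂quenchedLaw ω, Tendsto (fun t => M t X) atTop (𝓝 (G X)) := by
    filter_upwards [ae_isWalk ω, hhit] with X hX hhX
    obtain ⟨T, hT⟩ := exists_firstHit hhX
    refine tendsto_const_nhds.congr' ?_
    filter_upwards [eventually_ge_atTop T] with t ht
    rw [hG X hX T hT]
    simp only [hM, hQ, hT.hitBy_iff, ht, if_true, mul_one]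
    rw [← Finset.prod_range_mul_prod_Ico _ ht]
    rw [Finset.prod_congr rfl fun k hk => if_neg (not_le.2 (Finset.mem_range.1 hk)),
      Finset.prod_congr (s₁ := Finset.Ico T t) rfl fun k hk => if_pos (Finset.mem_Ico.1 hk).1]
    simp
  have := tendsto_integral_of_dominated_convergence (fun _ => (1 : ℝ))
    (fun t => (hMm t).aestronglyMeasurable) (integrable_const 1)
    (fun t => ae_of_all _ fun X => hMn t X) hlim
  simp_rw [hconst] at this
  exact tendsto_nhds_unique this tendsto_const_nhds

/-! ### Jump counts as sums over the steps of a path -/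

/-- The contribution of one step from `x` to `y` to the jump counts of the site `i`. -/
def stepCount (i x y : ℤ) : Fin 3 → ℕ :=
  ![if i = x ∧ y = x - 1 then 1 else 0, if i = x ∧ y = x - 2 then 1 else 0,
    if i = x - 1 ∧ y = x - 2 then 1 else 0]

theorem FirstHit.hittingTime_eq {n : ℤ} {T : ℕ} {X : ℕ → ℤ} (h : FirstHit n T X) :
    hittingTime n X = T := by
  refine le_antisymm (iInf₂_le T ⟨h.1, h.2.1⟩) (le_iInf₂ fun t ht => ?_)
  rw [Nat.cast_le]
  by_contra hc
  exact h.2.2 t ht.1 (not_le.1 hc) ht.2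

theorem ncard_step {X : ℕ → ℤ} {T : ℕ} {a b : ℤ}
    (hlast : ∀ k, k + 1 = T → ¬ (X k = a ∧ X (k + 1) = b)) :
    {k : ℕ | 0 < k ∧ (k : ℕ∞) < T ∧ X (k - 1) = a ∧ X k = b}.ncard
      = ∑ k ∈ Finset.range T, if X k = a ∧ X (k + 1) = b then 1 else 0 := by
  rw [← Finset.card_filter, ← Finset.card_image_of_injective _ Nat.succ_injective,
    ← Set.ncard_coe_finset]
  congr 1
  ext k
  simp only [Set.mem_ofPred_eq, Nat.cast_lt, Finset.coe_image, Finset.coe_filter, Finset.mem_range,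
    Set.mem_image]
  constructor
  · rintro ⟨h0, h1, h2, h3⟩
    obtain ⟨k, rfl⟩ : ∃ l, k = l + 1 := ⟨k - 1, by omega⟩
    exact ⟨k, ⟨by omega, h2, h3⟩, rfl⟩
  · rintro ⟨l, ⟨h1, h2, h3⟩, rfl⟩
    refine ⟨Nat.succ_pos l, ?_, h2, h3⟩
    rcases Nat.lt_or_eq_of_le (Nat.succ_le_of_lt h1) with h | h
    · exact h
    · exact absurd ⟨h2, h3⟩ (hlast l h)

theorem FirstHit.jumpCount_eq {n : ℤ} (hn : 0 < n) {T : ℕ} {X : ℕ → ℤ} (h : FirstHit n T X)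
    (hX : IsWalk X) (i : ℤ) :
    jumpCount n i X = ∑ k ∈ Finset.range T, stepCount i (X k) (X (k + 1)) := by
  -- The step into n starts below n and is therefore upward; the strict inequality k < T_n in the
  -- jump counts loses nothing.
  have hlast : ∀ k, k + 1 = T → X (k + 1) = X k + 1 := fun k hk => by
    have h1 := h.lt hn hX (show k < T by omega)
    have h2 := h.2.1
    rw [← hk] at h2
    rcases hX.2 k with h3 | h3 | h3 <;> omega
  funext σ
  rw [Finset.sum_apply]
  unfold jumpCount
  rw [h.hittingTime_eq]
  fin_cases σ
  · refine (ncard_step fun k hk hc => ?_).trans (Finset.sum_congr rfl fun k _ => ?_)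
    · have := hlast k hk
      omega
    · exact if_congr (by omega) rfl rfl
  · refine (ncard_step fun k hk hc => ?_).trans (Finset.sum_congr rfl fun k _ => ?_)
    · have := hlast k hk
      omega
    · exact if_congr (by omega) rfl rfl
  · refine (ncard_step fun k hk hc => ?_).trans (Finset.sum_congr rfl fun k _ => ?_)
    · have := hlast k hk
      omega
    · exact if_congr (by omega) rfl rfl

theorem FirstHit.jumpCount_self {n : ℤ} (hn : 0 < n) {T : ℕ} {X : ℕ → ℤ} (h : FirstHit n T X)
    (hX : IsWalk X) : jumpCount n n X = 0 := by
  rw [h.jumpCount_eq hn hX]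
  refine Finset.sum_eq_zero fun k hk => ?_
  have h1 := h.lt hn hX (Finset.mem_range.1 hk)
  have h2 : n ≠ X k := by omega
  have h3 : n ≠ X k - 1 := by omega
  funext σ
  fin_cases σ <;> simp [stepCount, h2, h3]

theorem hasSum_ite_coe_eq {s : Set ℤ} {x : ℤ} (hx : x ∈ s) (P : Prop) [Decidable P] (c : ℕ) :
    HasSum (fun k : s => if (k : ℤ) = x ∧ P then c else 0) (if P then c else 0) := by
  have := hasSum_single (f := fun k : s => if (k : ℤ) = x ∧ P then c else 0) ⟨x, hx⟩
    fun k hk => if_neg fun h => hk (Subtype.ext h.1)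
  simpa using this

theorem FirstHit.exists_hasSum {n : ℕ} (hn : 0 < n) {T : ℕ} {X : ℕ → ℤ} (h : FirstHit n T X)
    (hX : IsWalk X) : ∃ s : ℕ,
      HasSum (fun k : Set.Iic ((n : ℤ) - 1) => jumpCount n k X ⬝ᵥ ![2, 1, 2]) s ∧
      hittingTime n X = n + s := by
  have hn' : (0 : ℤ) < n := by exact_mod_cast hn
  -- A jump -2 from x is counted twice, at x with weight 1 and at x - 1 with weight 2; the total 3
  -- is one more than the descent, just as 2 is for a jump -1.
  set c : ℕ → ℕ := fun t => (if X (t + 1) = X t - 1 then 2 else 0)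
    + (if X (t + 1) = X t - 2 then 1 else 0) + if X (t + 1) = X t - 2 then 2 else 0 with hc
  refine ⟨∑ t ∈ Finset.range T, c t, ?_, ?_⟩
  · have h1 : ∀ k : Set.Iic ((n : ℤ) - 1), jumpCount n k X ⬝ᵥ ![2, 1, 2]
        = ∑ t ∈ Finset.range T, stepCount k (X t) (X (t + 1)) ⬝ᵥ ![2, 1, 2] := fun k => by
      rw [h.jumpCount_eq hn' hX, sum_dotProduct]
    simp_rw [h1]
    refine hasSum_sum fun t ht => ?_
    have hx := h.lt hn' hX (Finset.mem_range.1 ht)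
    have h2 := ((hasSum_ite_coe_eq (s := Set.Iic ((n : ℤ) - 1)) (x := X t) (Set.mem_Iic.2 (by omega))
      (X (t + 1) = X t - 1) 2).add
      (hasSum_ite_coe_eq (s := Set.Iic ((n : ℤ) - 1)) (x := X t) (Set.mem_Iic.2 (by omega))
      (X (t + 1) = X t - 2) 1)).add
      (hasSum_ite_coe_eq (s := Set.Iic ((n : ℤ) - 1)) (x := X t - 1) (Set.mem_Iic.2 (by omega))
      (X (t + 1) = X t - 2) 2)
    refine h2.congr_fun ?_
    intro k
    simp [stepCount, dotProduct, Fin.sum_univ_three]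
  · rw [h.hittingTime_eq]
    have h3 : ∀ t, (1 : ℤ) = (X (t + 1) - X t) + c t := fun t => by
      simp only [hc]
      rcases hX.2 t with h | h | h <;> (rw [h]; simp; try omega)
    have h4 : (T : ℤ) = n + ∑ t ∈ Finset.range T, (c t : ℤ) := by
      calc (T : ℤ) = ∑ t ∈ Finset.range T, (1 : ℤ) := by simp
        _ = ∑ t ∈ Finset.range T, ((X (t + 1) - X t) + (c t : ℤ)) :=
            Finset.sum_congr rfl fun t _ => h3 t
        _ = _ := by rw [Finset.sum_add_distrib, Finset.sum_range_sub, h.2.1, hX.1, sub_zero]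
    have h5 : T = n + ∑ t ∈ Finset.range T, c t := by exact_mod_cast h4
    exact_mod_cast h5

/-- The weight of a step from `x` to `y` when each jump counted at a site `i` is weighted by
`u i`. -/
noncomputable def stepWeight (u : ℤ → Fin 3 → ℂ) (x y : ℤ) : ℂ :=
  (if y = x - 1 then u x 0 else 1) * (if y = x - 2 then u x 1 else 1)
    * if y = x - 2 then u (x - 1) 2 else 1

/-- The product runs over the levels 0, …, n only. A step counted at a negative level meets no
factor, which is consistent because g is 1 there. -/
theorem prod_pow_ite_level {n : ℕ} {g : ℤ → ℂ} (hg : ∀ i < 0, g i = 1) {x : ℤ} (hx : x ≤ n)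
    (P : Prop) [Decidable P] :
    ∏ m : Fin (n + 1), g ((n : ℤ) - (m : ℕ)) ^ (if (n : ℤ) - (m : ℕ) = x ∧ P then 1 else 0)
      = if P then g x else 1 := by
  by_cases hP : P
  · simp only [hP, and_true, if_true]
    by_cases h0 : 0 ≤ x
    · rw [Finset.prod_eq_single (⟨((n : ℤ) - x).toNat, by omega⟩ : Fin (n + 1))]
      · have : (n : ℤ) - (((n : ℤ) - x).toNat : ℕ) = x := by omega
        simp only [this, if_true, pow_one]
      · intro m _ hm
        rw [if_neg, pow_zero]
        intro h
        refine hm (Fin.ext ?_)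
        simp only
        omega
      · simp
    · rw [hg x (by omega)]
      refine Finset.prod_eq_one fun m _ => ?_
      rw [if_neg, pow_zero]
      have := m.2
      omega
  · simp [hP]

theorem FirstHit.prod_pow_jumpCount {n : ℕ} (hn : 0 < n) {T : ℕ} {X : ℕ → ℤ} (h : FirstHit n T X)
    (hX : IsWalk X) {u : ℤ → Fin 3 → ℂ} (hu : ∀ i < 0, u i = 1) :
    ∏ m : Fin (n + 1), ∏ σ, u ((n : ℤ) - (m : ℕ)) σ ^ jumpCount n ((n : ℤ) - (m : ℕ)) X σ
      = ∏ k ∈ Finset.range T, stepWeight u (X k) (X (k + 1)) := by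
  have hn' : (0 : ℤ) < n := by exact_mod_cast hn
  have hu' : ∀ σ, ∀ i < 0, u i σ = 1 := fun σ i hi => by rw [hu i hi]; rfl
  simp_rw [h.jumpCount_eq hn' hX, Finset.sum_apply, ← Finset.prod_pow_eq_pow_sum]
  simp_rw [Finset.prod_comm (s := (Finset.univ : Finset (Fin 3)))]
  rw [Finset.prod_comm]
  refine Finset.prod_congr rfl fun k hk => ?_
  have hx := h.lt hn' hX (Finset.mem_range.1 hk)
  simp_rw [Fin.prod_univ_three, Finset.prod_mul_distrib]
  unfold stepWeight
  congr 1
  · congr 1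
    · exact prod_pow_ite_level (g := fun i => u i 0) (hu' 0) hx.le _
    · exact prod_pow_ite_level (g := fun i => u i 1) (hu' 1) hx.le _
  · exact prod_pow_ite_level (g := fun i => u i 2) (hu' 2) (by omega) _

open Classical in
-- Almost surely the count is the eventual value of sums stopped at the hitting time, each depending
-- on a finite part of the path.
theorem aemeasurable_jumpCount {ω : Env} {n : ℤ} (hn : 0 < n)
    (hhit : ∀ᵐ X ∂quenchedLaw ω, ∃ t, HitBy n t X) (i : ℤ) :
    AEMeasurable (jumpCount n i) (quenchedLaw ω) := by
  refine aemeasurable_pi_iff.2 fun σ => ?_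
  refine aemeasurable_of_tendsto_metrizable_ae (u := atTop) (f := fun t X =>
    ∑ k ∈ Finset.range t, if HitBy n k X then 0 else stepCount i (X k) (X (k + 1)) σ)
    (fun t => (measurable_of_past (t := t) fun X => ?_).aemeasurable) ?_
  · refine Finset.sum_congr rfl fun k hk => ?_
    have hk' := Finset.mem_range.1 hk
    simp only [hitBy_min hk'.le, min_eq_left hk'.le, min_eq_left (Nat.succ_le_of_lt hk')]
  · filter_upwards [ae_isWalk ω, hhit] with X hX hhX
    obtain ⟨T, hT⟩ := exists_firstHit hhX
    refine tendsto_const_nhds.congr' ?_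
    filter_upwards [eventually_ge_atTop T] with t ht
    rw [hT.jumpCount_eq hn hX, Finset.sum_apply, ← Finset.sum_range_add_sum_Ico _ ht]
    simp only [hT.hitBy_iff]
    rw [Finset.sum_congr rfl fun k hk => if_neg (not_le.2 (Finset.mem_range.1 hk)),
      Finset.sum_congr (s₁ := Finset.Ico T t) rfl fun k hk => if_pos (Finset.mem_Ico.1 hk).1]
    simp

/-! ### Offspring laws -/

theorem pairLaw_apply {p : StepLaw} (hp : 0 < prob p 1) (v : ℕ × ℕ) :
    pairLaw p v = ENNReal.ofReal (pairMass p v) := by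
  have h : pairLaw p = ⟨fun v => ENNReal.ofReal (pairMass p v), hasSum_pairMass p hp⟩ :=
    dif_pos hp
  rw [h]
  rfl

theorem offspringLaw_apply (p : StepLaw) (τ : Fin 3) (a b : ℕ) :
    offspringLaw p τ ![a, b, if τ = 1 then 1 else 0] = pairLaw p (a, b) := by
  rw [offspringLaw, PMF.map_apply, tsum_eq_single (a, b), if_pos rfl]
  intro v hv
  refine if_neg fun h => hv ?_
  have h0 := congrFun h 0
  have h1 := congrFun h 1
  exact Prod.ext h0.symm h1.symm

theorem summable_pairMass {p : StepLaw} (hp : 0 < prob p 1) : Summable (pairMass p) := by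
  have h := ENNReal.summable_toReal
    ((hasSum_pairMass p hp).tsum_eq.trans_ne ENNReal.one_ne_top)
  simpa only [ENNReal.toReal_ofReal (pairMass_nonneg p _)] using h

theorem sum_antidiagonal_pairMass_mul (p : StepLaw) (x y : ℂ) (N : ℕ) :
    ∑ v ∈ Finset.HasAntidiagonal.antidiagonal N, (pairMass p v : ℂ) * (x ^ v.1 * y ^ v.2)
      = (prob p (-1) * x + prob p (-2) * y) ^ N * prob p 1 := by
  rw [(Commute.all (prob p (-1) * x) (prob p (-2) * y)).add_pow', Finset.sum_mul]
  refine Finset.sum_congr rfl fun v hv => ?_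
  have hN : v.1 + v.2 = N := Finset.HasAntidiagonal.mem_antidiagonal.1 hv
  subst hN
  rw [pairMass, Nat.choose_symm_add, Nat.add_choose, nsmul_eq_mul,
    Nat.cast_div (Nat.factorial_mul_factorial_dvd_factorial_add _ _)
      (by exact_mod_cast (Nat.mul_pos (Nat.factorial_pos _) (Nat.factorial_pos _)).ne')]
  push_cast
  ring

theorem norm_jump_sum_le (p : StepLaw) {x y : ℂ} (hx : ‖x‖ ≤ 1) (hy : ‖y‖ ≤ 1) :
    ‖(prob p (-1) : ℂ) * x + prob p (-2) * y‖ ≤ 1 - prob p 1 := by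
  have h1 := prob_nonneg p (-1)
  have h2 := prob_nonneg p (-2)
  refine (norm_add_le _ _).trans ?_
  rw [norm_mul, norm_mul, Complex.norm_real, Complex.norm_real, Real.norm_of_nonneg h1,
    Real.norm_of_nonneg h2]
  nlinarith [prob_sum p]

/-- Grouping the pairs by their sum N gives the binomial expansion of (p(-1)x + p(-2)y)^N p(1), and
then a geometric series of ratio at most 1 - p(1) in modulus. -/
theorem tsum_pairMass_mul {p : StepLaw} (hp : 0 < prob p 1) {x y : ℂ} (hx : ‖x‖ ≤ 1)
    (hy : ‖y‖ ≤ 1) :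
    ∑' v : ℕ × ℕ, (pairMass p v : ℂ) * (x ^ v.1 * y ^ v.2)
      = prob p 1 / (1 - (prob p (-1) * x + prob p (-2) * y)) := by
  have hs : Summable fun v : ℕ × ℕ => (pairMass p v : ℂ) * (x ^ v.1 * y ^ v.2) := by
    refine Summable.of_norm_bounded (summable_pairMass hp) fun v => ?_
    rw [norm_mul, norm_mul, norm_pow, norm_pow, Complex.norm_real,
      Real.norm_of_nonneg (pairMass_nonneg p v)]
    exact mul_le_of_le_one_right (pairMass_nonneg p v) (mul_le_one₀
      (pow_le_one₀ (norm_nonneg _) hx) (by positivity) (pow_le_one₀ (norm_nonneg _) hy))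
  rw [← (Finset.HasAntidiagonal.sigmaAntidiagonalEquivProd (A := ℕ)).tsum_eq]
  have hs' := (Finset.HasAntidiagonal.sigmaAntidiagonalEquivProd (A := ℕ)).summable_iff.2 hs
  simp only [Function.comp_def] at hs'
  rw [Summable.tsum_sigma' (fun N => (hasSum_fintype _).summable) hs']
  have key : ∀ N : ℕ, ∑' v : Finset.HasAntidiagonal.antidiagonal N,
      (pairMass p (Finset.HasAntidiagonal.sigmaAntidiagonalEquivProd ⟨N, v⟩) : ℂ)
        * (x ^ (Finset.HasAntidiagonal.sigmaAntidiagonalEquivProd ⟨N, v⟩).1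
          * y ^ (Finset.HasAntidiagonal.sigmaAntidiagonalEquivProd ⟨N, v⟩).2)
        = (prob p (-1) * x + prob p (-2) * y) ^ N * prob p 1 := fun N => by
    rw [tsum_fintype, ← sum_antidiagonal_pairMass_mul]
    exact Finset.sum_coe_sort (Finset.HasAntidiagonal.antidiagonal N)
      fun v => (pairMass p v : ℂ) * (x ^ v.1 * y ^ v.2)
  simp_rw [key]
  rw [tsum_mul_right, tsum_geometric_of_norm_lt_one
    ((norm_jump_sum_le p hx hy).trans_lt (by linarith)), div_eq_inv_mul]

theorem integral_offspringLaw {p : StepLaw} (hp : 0 < prob p 1) (τ : Fin 3) {x : Fin 3 → ℂ}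
    (hx : ∀ σ, ‖x σ‖ ≤ 1) :
    ∫ v, ∏ σ, x σ ^ v σ ∂(offspringLaw p τ).toMeasure
      = prob p 1 / (1 - (prob p (-1) * x 0 + prob p (-2) * x 1)) * (if τ = 1 then x 2 else 1) := by
  rw [offspringLaw, ← PMF.toMeasure_map _ _ (measurable_of_countable _),
    integral_map (measurable_of_countable _).aemeasurable
      (measurable_of_countable _).aestronglyMeasurable,
    PMF.integral_eq_tsum, ← tsum_pairMass_mul hp (hx 0) (hx 1), ← tsum_mul_right]
  · refine tsum_congr fun v => ?_
    rw [pairLaw_apply hp, ENNReal.toReal_ofReal (pairMass_nonneg p v), Fin.prod_univ_three,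
      Complex.real_smul]
    split_ifs <;> simp [mul_assoc]
  · refine Integrable.of_bound (measurable_of_countable _).aestronglyMeasurable 1
      (ae_of_all _ fun v => ?_)
    rw [norm_prod]
    refine Finset.prod_le_one (fun _ _ => norm_nonneg _) fun σ _ => ?_
    rw [norm_pow]
    exact pow_le_one₀ (norm_nonneg _) (hx σ)

/-! ### Generating functions of the branching process -/

/-- The number of individuals of each type that reproduce in a generation with population `z`:
one immigrant of the first type is added. -/
def parents (z : Fin 3 → ℕ) (τ : Fin 3) : ℕ := if τ = 0 then 1 + z 0 else z τ

theorem generation_succ (ξ : ℕ × Fin 3 × ℕ → Fin 3 → ℕ) (m : ℕ) :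
    generation ξ (m + 1)
      = ∑ τ, ∑ j ∈ Finset.range (parents (generation ξ m) τ), ξ (m, τ, j) := by
  rw [Fin.sum_univ_three]
  rfl

theorem generation_congr {ξ η : ℕ × Fin 3 × ℕ → Fin 3 → ℕ} {m : ℕ}
    (h : ∀ k < m, ∀ r, ξ (k, r) = η (k, r)) {k : ℕ} (hk : k ≤ m) :
    generation ξ k = generation η k := by
  induction k with
  | zero => rfl
  | succ k ih =>
    rw [generation_succ, generation_succ, ih (by omega)]
    exact Finset.sum_congr rfl fun τ _ => Finset.sum_congr rfl fun j _ => h k hk _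

section Branching

variable (q : ℕ → Fin 3 → PMF (Fin 3 → ℕ))

/-- The law of all the offspring variables. -/
noncomputable def offspringField : Measure (ℕ × Fin 3 × ℕ → Fin 3 → ℕ) :=
  Measure.infinitePi fun k : ℕ × Fin 3 × ℕ => (q k.1 k.2.1).toMeasure

instance isProbabilityMeasure_offspringField : IsProbabilityMeasure (offspringField q) := by
  unfold offspringField
  infer_instance

/-- The generations up to time m use only offspring rows with index below m, and distinct rows are
independent. -/
theorem indepFun_generation (m : ℕ) :
    IndepFun (fun ξ (k : Fin (m + 1)) => generation ξ k) (fun ξ (r : Fin 3 × ℕ) => ξ (m, r))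
      (offspringField q) := by
  have hm : ∀ k : ℕ, Measurable fun (ξ : ℕ × Fin 3 × ℕ → Fin 3 → ℕ) (r : Fin 3 × ℕ) => ξ (k, r) :=
    fun k => by fun_prop
  have hmap : ∀ k : ℕ, (offspringField q).map (fun ξ (r : Fin 3 × ℕ) => ξ (k, r))
      = Measure.infinitePi fun r : Fin 3 × ℕ => (q k r.1).toMeasure := fun k =>
    Measure.map_infinitePi_infinitePi_of_inj
      (P := fun k : ℕ × Fin 3 × ℕ => (q k.1 k.2.1).toMeasure) (f := fun r => (k, r))
      fun r s h => (Prod.ext_iff.1 h).2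
  have hind : iIndepFun (fun (k : ℕ) (ξ : ℕ × Fin 3 × ℕ → Fin 3 → ℕ) (r : Fin 3 × ℕ) => ξ (k, r))
      (offspringField q) := by
    rw [iIndepFun_iff_map_fun_eq_infinitePi_map hm]
    simp_rw [hmap]
    exact Measure.infinitePi_map_curry fun (k : ℕ) (r : Fin 3 × ℕ) => (q k r.1).toMeasure
  have h := hind.indepFun_finset (Finset.range m) {m} (by simp) hm
  -- Rows from m on are filled with zeros, so that `generation` can be evaluated on the first m rows
  -- alone.
  let pad : ((i : Finset.range m) → Fin 3 × ℕ → Fin 3 → ℕ) → ℕ × Fin 3 × ℕ → Fin 3 → ℕ :=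
    fun z p => if hp : p.1 ∈ Finset.range m then z ⟨p.1, hp⟩ p.2 else 0
  have hpad : Measurable pad := by
    refine measurable_pi_lambda _ fun p => ?_
    by_cases hp : p.1 ∈ Finset.range m
    · simp only [pad, hp, dif_pos]
      exact (measurable_pi_apply p.2).comp (measurable_pi_apply _)
    · simp only [pad, hp, dif_neg, not_false_eq_true]
      exact measurable_const
  have hgen : Measurable fun (z : (i : Finset.range m) → Fin 3 × ℕ → Fin 3 → ℕ)
      (k : Fin (m + 1)) => generation (pad z) k :=
    measurable_pi_lambda _ fun k =>
      (measurable_pi_apply (k : ℕ)).comp (measurable_generation.comp hpad)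
  have hlast : Measurable fun z : (i : ({m} : Finset ℕ)) → Fin 3 × ℕ → Fin 3 → ℕ =>
      z ⟨m, Finset.mem_singleton_self m⟩ := measurable_pi_apply _
  have hres := h.comp hgen hlast
  refine hres.congr (ae_of_all _ fun ξ => ?_) (ae_of_all _ fun ξ => rfl)
  funext k
  refine generation_congr (m := m) (fun l hl r => ?_) (Nat.lt_succ_iff.1 k.2)
  simp [pad, hl]

theorem integral_prod_offspring (m : ℕ) (N : Fin 3 → ℕ) (f : (Fin 3 → ℕ) → ℂ) :
    ∫ y : Fin 3 × ℕ → Fin 3 → ℕ, ∏ τ, ∏ j ∈ Finset.range (N τ), f (y (τ, j))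
        ∂(Measure.infinitePi fun r : Fin 3 × ℕ => (q m r.1).toMeasure)
      = ∏ τ, (∫ v, f v ∂(q m τ).toMeasure) ^ N τ := by
  have hinj : Function.Injective fun r : (τ : Fin 3) × Fin (N τ) => (r.1, (r.2 : ℕ)) := by
    rintro ⟨τ, j⟩ ⟨τ', j'⟩ h
    obtain ⟨rfl, h2⟩ := Prod.ext_iff.1 h
    simp only at h2
    rw [Fin.ext h2]
  have h1 : ∀ y : Fin 3 × ℕ → Fin 3 → ℕ, ∏ τ, ∏ j ∈ Finset.range (N τ), f (y (τ, j))
      = ∏ r : (τ : Fin 3) × Fin (N τ), f (y (r.1, (r.2 : ℕ))) := fun y => by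
    rw [Fintype.prod_sigma]
    exact Finset.prod_congr rfl fun τ _ => Finset.prod_range _
  simp_rw [h1]
  have h2 := Measure.map_infinitePi_infinitePi_of_inj
    (P := fun r : Fin 3 × ℕ => (q m r.1).toMeasure) hinj
  have hf : Measurable f := measurable_of_countable f
  have hre : Measurable fun (y : Fin 3 × ℕ → Fin 3 → ℕ) (r : (τ : Fin 3) × Fin (N τ)) =>
      y (r.1, (r.2 : ℕ)) := by fun_prop
  rw [← integral_map (f := fun z : (τ : Fin 3) × Fin (N τ) → Fin 3 → ℕ => ∏ r, f (z r))
    hre.aemeasurable (Finset.measurable_prod _ fun r _ =>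
      hf.comp (measurable_pi_apply r)).aestronglyMeasurable, h2, Measure.infinitePi_eq_pi,
    integral_fintype_prod_eq_prod (f := fun _ => f), Fintype.prod_sigma]
  simp

/-- The history determines the numbers of parents and is independent of row m. With these numbers
frozen, the product over the children factorizes. -/
theorem integral_generation_succ (m : ℕ) {K : (Fin (m + 1) → Fin 3 → ℕ) → ℂ} (hK : ∀ d, ‖K d‖ ≤ 1)
    {f : (Fin 3 → ℕ) → ℂ} (hf : ∀ v, ‖f v‖ ≤ 1) :
    ∫ ξ, K (fun k => generation ξ k)
        * ∏ τ, ∏ j ∈ Finset.range (parents (generation ξ m) τ), f (ξ (m, τ, j)) ∂offspringField q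
      = ∫ ξ, K (fun k => generation ξ k)
        * ∏ τ, (∫ v, f v ∂(q m τ).toMeasure) ^ parents (generation ξ m) τ ∂offspringField q := by
  set D : (ℕ × Fin 3 × ℕ → Fin 3 → ℕ) → Fin (m + 1) → Fin 3 → ℕ := fun ξ k => generation ξ k
  set Y : (ℕ × Fin 3 × ℕ → Fin 3 → ℕ) → Fin 3 × ℕ → Fin 3 → ℕ := fun ξ r => ξ (m, r)
  have hD : Measurable D := measurable_pi_lambda _ fun k =>
    (measurable_pi_apply (k : ℕ)).comp measurable_generation
  have hY : Measurable Y := by fun_prop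
  have hYmap : (offspringField q).map Y
      = Measure.infinitePi fun r : Fin 3 × ℕ => (q m r.1).toMeasure :=
    Measure.map_infinitePi_infinitePi_of_inj
      (P := fun k : ℕ × Fin 3 × ℕ => (q k.1 k.2.1).toMeasure) (f := fun r => (m, r))
      fun r s h => (Prod.ext_iff.1 h).2
  have hDY := (indepFun_iff_map_prod_eq_prod_map_map hD.aemeasurable hY.aemeasurable).1
    (indepFun_generation q m)
  obtain ⟨F, hF⟩ : ∃ F : (Fin (m + 1) → Fin 3 → ℕ) × (Fin 3 × ℕ → Fin 3 → ℕ) → ℂ, ∀ z, F z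
      = K z.1 * ∏ τ, ∏ j ∈ Finset.range (parents (z.1 (Fin.last m)) τ), f (z.2 (τ, j)) :=
    ⟨_, fun _ => rfl⟩
  have hfm : Measurable f := measurable_of_countable f
  have hFm : Measurable F := by
    -- The history takes countably many values, and for each of them the number of factors is fixed.
    refine measurable_from_prod_countable_right fun d => ?_
    simp only [hF]
    fun_prop
  have hFn : ∀ z, ‖F z‖ ≤ 1 := fun z => by
    rw [hF, norm_mul, norm_prod]
    refine mul_le_one₀ (hK _) (Finset.prod_nonneg fun _ _ => norm_nonneg _)
      (Finset.prod_le_one (fun _ _ => norm_nonneg _) fun τ _ => ?_)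
    rw [norm_prod]
    exact Finset.prod_le_one (fun _ _ => norm_nonneg _) fun j _ => hf _
  have hp1 : IsProbabilityMeasure ((offspringField q).map D) :=
    Measure.isProbabilityMeasure_map hD.aemeasurable
  have hp2 : IsProbabilityMeasure ((offspringField q).map Y) :=
    Measure.isProbabilityMeasure_map hY.aemeasurable
  calc _ = ∫ ξ, F (D ξ, Y ξ) ∂offspringField q :=
        integral_congr_ae (ae_of_all _ fun ξ => (hF (D ξ, Y ξ)).symm)
    _ = ∫ d, ∫ y, F (d, y) ∂(offspringField q).map Y ∂(offspringField q).map D := by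
        rw [← integral_prod _ (Integrable.of_bound hFm.aestronglyMeasurable 1
          (ae_of_all _ hFn)), ← hDY, integral_map (by fun_prop) hFm.aestronglyMeasurable]
    _ = ∫ d, K d * ∏ τ, (∫ v, f v ∂(q m τ).toMeasure) ^ parents (d (Fin.last m)) τ
          ∂(offspringField q).map D := by
        refine integral_congr_ae (ae_of_all _ fun d => ?_)
        simp only [hF]
        rw [integral_const_mul, hYmap, integral_prod_offspring]
    _ = _ := by
        rw [integral_map hD.aemeasurable (measurable_of_countable _).aestronglyMeasurable]
        rfl

theorem norm_prod_pow_le_one {ι : Type*} [Fintype ι] {x : ι → ℂ} (hx : ∀ i, ‖x i‖ ≤ 1)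
    (v : ι → ℕ) : ‖∏ i, x i ^ v i‖ ≤ 1 := by
  rw [norm_prod]
  refine Finset.prod_le_one (fun _ _ => norm_nonneg _) fun i _ => ?_
  rw [norm_pow]
  exact pow_le_one₀ (norm_nonneg _) (hx i)

/-- Φ m τ plays the role of the generating function of the progeny, after time m, of an individual
of type τ. Integrating out one generation turns Φ (m + 1) into Φ m for every parent, and the
immigrant leaves the extra factor Φ m 0. -/
theorem integral_prod_pow_generation {n : ℕ} {s Φ : ℕ → Fin 3 → ℂ} (hs : ∀ m σ, ‖s m σ‖ ≤ 1)
    (hΦ : ∀ m σ, ‖Φ m σ‖ ≤ 1)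
    (hq : ∀ m < n, ∀ τ, ∫ v, ∏ σ, (s (m + 1) σ * Φ (m + 1) σ) ^ v σ ∂(q m τ).toMeasure = Φ m τ)
    {m : ℕ} (hm : m ≤ n) :
    ∫ ξ, (∏ k : Fin (m + 1), ∏ σ, s k σ ^ generation ξ k σ) * ∏ σ, Φ m σ ^ generation ξ m σ
      ∂offspringField q = ∏ k ∈ Finset.range m, Φ k 0 := by
  induction m with
  | zero => simp [generation]
  | succ m ih =>
    set f : (Fin 3 → ℕ) → ℂ := fun v => ∏ σ, (s (m + 1) σ * Φ (m + 1) σ) ^ v σ with hf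
    have hfn : ∀ v, ‖f v‖ ≤ 1 := norm_prod_pow_le_one fun σ => by
      rw [norm_mul]
      exact mul_le_one₀ (hs _ _) (norm_nonneg _) (hΦ _ _)
    have h1 : ∀ ξ, (∏ k : Fin (m + 1 + 1), ∏ σ, s k σ ^ generation ξ k σ)
          * ∏ σ, Φ (m + 1) σ ^ generation ξ (m + 1) σ
        = (∏ k : Fin (m + 1), ∏ σ, s k σ ^ generation ξ k σ)
          * ∏ τ, ∏ j ∈ Finset.range (parents (generation ξ m) τ), f (ξ (m, τ, j)) := fun ξ => by
      rw [Fin.prod_univ_castSucc, mul_assoc]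
      congr 1
      simp only [Fin.val_last, ← Finset.prod_mul_distrib, ← mul_pow, hf]
      rw [generation_succ]
      simp_rw [Finset.sum_apply, ← Finset.prod_pow_eq_pow_sum]
      rw [Finset.prod_comm]
      exact Finset.prod_congr rfl fun τ _ => Finset.prod_comm
    simp_rw [h1]
    rw [integral_generation_succ q m (K := fun d => ∏ k : Fin (m + 1), ∏ σ, s k σ ^ d k σ) (fun d => by
      rw [norm_prod]
      exact Finset.prod_le_one (fun _ _ => norm_nonneg _) fun k _ =>
        norm_prod_pow_le_one (hs k) _) hfn, Finset.prod_range_succ, ← ih (by omega),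
      ← integral_mul_const]
    refine integral_congr_ae (ae_of_all _ fun ξ => ?_)
    simp only [hf, hq m hm]
    rw [mul_assoc]
    congr 1
    simp only [Fin.prod_univ_three, parents]
    simp
    ring

end Branching

/-! ### The common recursion for the generating functions -/

/-- The pairs `(F (k - 1), F (k - 2))`, where `F i` is the generating function of the jumps counted
by `u` during the passage from the site `i` to `i + 1`, with `F i = 1` for `i < 0`. -/
noncomputable def passagePair (ω : Env) (u : ℤ → Fin 3 → ℂ) : ℕ → ℂ × ℂ
  | 0 => (1, 1)
  | k + 1 =>
      (prob (ω k) 1 / (1 - (prob (ω k) (-1) * (u k 0 * (passagePair ω u k).1)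
        + prob (ω k) (-2) * (u k 1 * ((passagePair ω u k).1 * u (k - 1) 2
          * (passagePair ω u k).2)))), (passagePair ω u k).1)

/-- The generating function of the jumps counted by `u` during the passage from `i` to `i + 1`. -/
noncomputable def passageGF (ω : Env) (u : ℤ → Fin 3 → ℂ) (i : ℤ) : ℂ :=
  (passagePair ω u (i + 1).toNat).1

section PassageGF

variable {ω : Env} {u : ℤ → Fin 3 → ℂ}

theorem passageGF_of_neg {i : ℤ} (hi : i < 0) : passageGF ω u i = 1 := by
  rw [passageGF, show (i + 1).toNat = 0 by omega]
  rfl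

theorem passagePair_eq (k : ℕ) :
    passagePair ω u k = (passageGF ω u (k - 1), passageGF ω u (k - 2)) := by
  refine Prod.ext ?_ ?_
  · rw [passageGF, show ((k : ℤ) - 1 + 1).toNat = k by omega]
  · change (passagePair ω u k).2 = passageGF ω u (k - 2)
    cases k with
    | zero => rw [passageGF_of_neg (by simp)]; rfl
    | succ k => rw [passageGF, show (((k + 1 : ℕ) : ℤ) - 2 + 1).toNat = k by omega]; rfl

/-- Below level 0 all weights are 1, and the constant 1 solves the recursion since 1 - p(-1) - p(-2)
= p(1); no boundary case remains. -/
theorem passageGF_eq (hω : ∀ x, 0 < prob (ω x) 1) (hu : ∀ i < 0, u i = 1) (i : ℤ) :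
    passageGF ω u i = prob (ω i) 1 / (1 - (prob (ω i) (-1) * (u i 0 * passageGF ω u (i - 1))
      + prob (ω i) (-2)
        * (u i 1 * (passageGF ω u (i - 1) * u (i - 1) 2 * passageGF ω u (i - 2))))) := by
  by_cases hi : 0 ≤ i
  · lift i to ℕ using hi
    rw [passageGF, show ((i : ℤ) + 1).toNat = i + 1 by omega, passagePair, passagePair_eq]
  · rw [not_le] at hi
    rw [passageGF_of_neg hi, passageGF_of_neg (by omega), passageGF_of_neg (by omega), hu i hi,
      hu (i - 1) (by omega)]
    have h1 : (prob (ω i) (-2) : ℂ) + prob (ω i) (-1) + prob (ω i) 1 = 1 := by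
      exact_mod_cast prob_sum (ω i)
    have h2 : (prob (ω i) 1 : ℂ) ≠ 0 := by exact_mod_cast (hω i).ne'
    simp only [Pi.one_apply, mul_one]
    rw [show (1 : ℂ) - (prob (ω i) (-1) + prob (ω i) (-2)) = prob (ω i) 1 by
      linear_combination -h1, div_self h2]

theorem prob_le_norm_one_sub (p : StepLaw) {x y : ℂ} (hx : ‖x‖ ≤ 1) (hy : ‖y‖ ≤ 1) :
    prob p 1 ≤ ‖1 - ((prob p (-1) : ℂ) * x + prob p (-2) * y)‖ := by
  have h1 := norm_jump_sum_le p hx hy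
  have h2 := norm_sub_norm_le (1 : ℂ) ((prob p (-1) : ℂ) * x + prob p (-2) * y)
  rw [norm_one] at h2
  linarith

theorem norm_triple_le_one {a b c d : ℂ} (ha : ‖a‖ ≤ 1) (hb : ‖b‖ ≤ 1) (hc : ‖c‖ ≤ 1)
    (hd : ‖d‖ ≤ 1) : ‖a * (b * c * d)‖ ≤ 1 := by
  simp only [norm_mul]
  exact mul_le_one₀ ha (by positivity)
    (mul_le_one₀ (mul_le_one₀ hb (norm_nonneg _) hc) (norm_nonneg _) hd)

theorem norm_mul_le_one {a b : ℂ} (ha : ‖a‖ ≤ 1) (hb : ‖b‖ ≤ 1) : ‖a * b‖ ≤ 1 := by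
  rw [norm_mul]
  exact mul_le_one₀ ha (norm_nonneg _) hb

theorem norm_passageGF_le (hω : ∀ x, 0 < prob (ω x) 1) (hn : ∀ i σ, ‖u i σ‖ ≤ 1) (i : ℤ) : ‖passageGF ω u i‖ ≤ 1 := by
  have h : ∀ k : ℕ, ‖(passagePair ω u k).1‖ ≤ 1 ∧ ‖(passagePair ω u k).2‖ ≤ 1 := by
    intro k
    induction k with
    | zero => simp [passagePair]
    | succ k ih =>
      refine ⟨?_, ih.1⟩
      rw [passagePair, norm_div, Complex.norm_real, Real.norm_of_nonneg (hω _).le]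
      exact div_le_one_of_le₀ (prob_le_norm_one_sub _ (norm_mul_le_one (hn _ _) ih.1)
        (norm_triple_le_one (hn _ _) ih.1 (hn _ _) ih.2)) (norm_nonneg _)
  exact (h _).1

theorem passageGF_eq_sum (hω : ∀ x, 0 < prob (ω x) 1) (hu : ∀ i < 0, u i = 1)
    (hn : ∀ i σ, ‖u i σ‖ ≤ 1) (i : ℤ) :
    passageGF ω u i = prob (ω i) 1 + (prob (ω i) (-1) * (u i 0 * passageGF ω u (i - 1))
      + prob (ω i) (-2) * (u i 1 * (passageGF ω u (i - 1) * u (i - 1) 2 * passageGF ω u (i - 2))))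
        * passageGF ω u i := by
  have h1 := passageGF_eq hω hu i
  have hF := norm_passageGF_le hω hn
  have h2 := prob_le_norm_one_sub (ω i) (norm_mul_le_one (hn i 0) (hF (i - 1)))
    (norm_triple_le_one (hn i 1) (hF (i - 1)) (hn (i - 1) 2) (hF (i - 2)))
  have h3 := norm_pos_iff.1 ((hω i).trans_le h2)
  rw [eq_div_iff h3] at h1
  linear_combination h1

/-- After a jump from x to x - 1 or x - 2 every lost level must be crossed again, so the weighted
value from x is the product of the passage generating functions over [x, n); the first-step equation
makes it harmonic. -/
theorem integral_prod_pow_jumpCount (hω : ∀ x, 0 < prob (ω x) 1) {n : ℕ} (hn0 : 0 < n)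
    (hhit : ∀ᵐ X ∂quenchedLaw ω, ∃ t, HitBy n t X) (hu : ∀ i < 0, u i = 1)
    (hn : ∀ i σ, ‖u i σ‖ ≤ 1) :
    ∫ X, ∏ m : Fin (n + 1), ∏ σ, u ((n : ℤ) - (m : ℕ)) σ ^ jumpCount n ((n : ℤ) - (m : ℕ)) X σ
      ∂quenchedLaw ω = ∏ j ∈ Finset.Ico (0 : ℤ) n, passageGF ω u j := by
  have hF := norm_passageGF_le hω hn
  refine integral_weight_eq (w := stepWeight u)
    (V := fun x => ∏ j ∈ Finset.Ico x n, passageGF ω u j) (by exact_mod_cast hn0) hhit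
    (fun x y => ?_) (fun x => ?_) (by simp) (fun x hx => ?_)
    fun X hX T hT => hT.prod_pow_jumpCount hn0 hX hu
  · unfold stepWeight
    refine norm_mul_le_one (norm_mul_le_one ?_ ?_) ?_ <;> split_ifs <;> simp [hn]
  · rw [norm_prod]
    exact Finset.prod_le_one (fun _ _ => norm_nonneg _) fun j _ => hF j
  · have hs : ∀ x < (n : ℤ), ∏ j ∈ Finset.Ico x (n : ℤ), passageGF ω u j
        = passageGF ω u x * ∏ j ∈ Finset.Ico (x + 1) (n : ℤ), passageGF ω u j := fun x hx => by
      rw [← Finset.insert_Ico_add_one_left_eq_Ico hx, Finset.prod_insert (by simp)]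
    have w1 : stepWeight u x (x - 1) = u x 0 := by
      simp [stepWeight]
    have w2 : stepWeight u x (x - 2) = u x 1 * u (x - 1) 2 := by
      simp [stepWeight]
    have w3 : stepWeight u x (x + 1) = 1 := by
      have h1 : x + 1 ≠ x - 1 := by omega
      have h2 : x + 1 ≠ x - 2 := by omega
      simp [stepWeight, h1, h2]
    have e1 := hs (x - 1) (by omega)
    have e2 := hs (x - 2) (by omega)
    rw [sub_add_cancel] at e1
    rw [show x - 2 + 1 = x - 1 by ring, e1, hs x hx] at e2
    rw [hs x hx] at e1
    rw [w1, w2, w3]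
    rw [hs x hx, e1, e2]
    have hx1 := passageGF_eq_sum hω hu hn x
    linear_combination (∏ j ∈ Finset.Ico (x + 1) (n : ℤ), passageGF ω u j) * hx1

theorem integral_prod_pow_branchingLaw (hω : ∀ x, 0 < prob (ω x) 1) (n : ℕ)
    (hu : ∀ i < 0, u i = 1) (hn : ∀ i σ, ‖u i σ‖ ≤ 1) :
    ∫ Z, ∏ m : Fin (n + 1), ∏ σ, u ((n : ℤ) - (m : ℕ)) σ ^ Z m σ
        ∂(branchingLaw fun m => offspringLaw (ω ((n : ℤ) - 1 - m)))
      = ∏ j ∈ Finset.Ico (0 : ℤ) n, passageGF ω u j := by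
  have hF := norm_passageGF_le hω hn
  set q : ℕ → Fin 3 → PMF (Fin 3 → ℕ) := fun m => offspringLaw (ω ((n : ℤ) - 1 - m))
  set s : ℕ → Fin 3 → ℂ := fun m => u ((n : ℤ) - m) with hs
  -- Put i = n - 1 - m. An individual at time m is a jump counted at level i + 1. For types 1 and 3
  -- it is followed by a passage from i to i + 1. Type 2 is a jump i + 1 → i - 1, hence the
  -- additional weight u_{i,3} and passage from i - 1 to i.
  set Φ : ℕ → Fin 3 → ℂ := fun m τ => passageGF ω u ((n : ℤ) - 1 - m) * if τ = 1 then
    u ((n : ℤ) - 1 - m) 2 * passageGF ω u ((n : ℤ) - 1 - m - 1) else 1 with hΦ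
  have hΦn : ∀ m τ, ‖Φ m τ‖ ≤ 1 := fun m τ => by
    simp only [hΦ]
    refine norm_mul_le_one (hF _) ?_
    split_ifs
    · exact norm_mul_le_one (hn _ _) (hF _)
    · simp
  have hq : ∀ m < n, ∀ τ, ∫ v, ∏ σ, (s (m + 1) σ * Φ (m + 1) σ) ^ v σ ∂(q m τ).toMeasure
      = Φ m τ := by
    intro m hm τ
    rw [integral_offspringLaw (hω _) τ fun σ => norm_mul_le_one (hn _ _) (hΦn _ _)]
    simp only [hΦ]
    have e1 : (n : ℤ) - ((m + 1 : ℕ) : ℤ) = n - 1 - m := by push_cast; ring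
    have e2 : (n : ℤ) - 1 - ((m + 1 : ℕ) : ℤ) = n - 1 - m - 1 := by push_cast; ring
    rw [e1, e2]
    generalize (n : ℤ) - 1 - m = i
    rw [passageGF_eq hω hu i, show i - 1 - 1 = i - 2 by ring]
    simp [mul_assoc]
  have hgf := integral_prod_pow_generation q (s := s) (fun m σ => hn _ _) hΦn hq le_rfl
  -- Generation n is level 0; its progeny lives at negative levels, where nothing is weighted.
  have hΦl : ∀ τ, Φ n τ = 1 := fun τ => by
    simp only [hΦ]
    rw [passageGF_of_neg (by omega), passageGF_of_neg (by omega), hu _ (by omega)]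
    simp
  simp only [hΦl, one_pow, Finset.prod_const_one, mul_one] at hgf
  have hmap : branchingLaw q = (offspringField q).map generation := rfl
  rw [hmap, integral_map measurable_generation.aemeasurable]
  · rw [show (∏ j ∈ Finset.Ico (0 : ℤ) n, passageGF ω u j)
        = ∏ k ∈ Finset.range n, passageGF ω u ((n : ℤ) - 1 - k) from ?_]
    · simpa [hΦ] using hgf
    · symm
      refine Finset.prod_bij (fun k _ => (n : ℤ) - 1 - k) ?_ ?_ ?_ fun _ _ => rfl
      · intro k hk
        have := Finset.mem_range.1 hk
        rw [Finset.mem_Ico]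
        omega
      · intro k _ l _ h
        omega
      · intro j hj
        have := Finset.mem_Ico.1 hj
        exact ⟨((n : ℤ) - 1 - j).toNat, Finset.mem_range.2 (by omega), by omega⟩
  · refine Measurable.aestronglyMeasurable ?_
    refine Finset.measurable_prod _ fun m _ => Finset.measurable_prod _ fun σ _ => ?_
    exact (measurable_of_countable fun v : Fin 3 → ℕ => u ((n : ℤ) - (m : ℕ)) σ ^ v σ).comp
      (measurable_pi_apply (m : ℕ))

end PassageGF

/-! ### Laws on count vectors and their characteristic functions -/

/-- Weights exp (i t) turn these integrals into characteristic functions of the count vectors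
embedded in a Euclidean space, and the embedding loses no information. -/
theorem ext_of_integral_prod_pow {n : ℕ} {P Q : Measure (Fin (n + 1) → Fin 3 → ℕ)}
    [IsProbabilityMeasure P] [IsProbabilityMeasure Q]
    (h : ∀ u : ℤ → Fin 3 → ℂ, (∀ i < 0, u i = 1) → (∀ i σ, ‖u i σ‖ ≤ 1) →
      ∫ x, ∏ m : Fin (n + 1), ∏ σ, u ((n : ℤ) - (m : ℕ)) σ ^ x m σ ∂P
        = ∫ x, ∏ m : Fin (n + 1), ∏ σ, u ((n : ℤ) - (m : ℕ)) σ ^ x m σ ∂Q) : P = Q := by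
  set E : (Fin (n + 1) → Fin 3 → ℕ) → EuclideanSpace ℝ (Fin (n + 1) × Fin 3) :=
    fun x => WithLp.toLp 2 fun r => (x r.1 r.2 : ℝ) with hE
  have hEm : Measurable E := measurable_of_countable E
  have hEe : MeasurableEmbedding E :=
    ⟨fun x y hxy => by
      funext m σ
      have := congrArg (fun z : EuclideanSpace ℝ (Fin (n + 1) × Fin 3) => z (m, σ)) hxy
      simpa [hE] using this,
    hEm, fun s _ => (s.to_countable.image E).measurableSet⟩
  have hP : IsProbabilityMeasure (P.map E) := Measure.isProbabilityMeasure_map hEm.aemeasurable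
  have hQ : IsProbabilityMeasure (Q.map E) := Measure.isProbabilityMeasure_map hEm.aemeasurable
  have key : P.map E = Q.map E := by
    refine Measure.ext_of_charFun (funext fun t => ?_)
    -- Only the levels 0, …, n enter the product, so the values of `u` above n are irrelevant.
    set u : ℤ → Fin 3 → ℂ := fun i σ => if i < 0 then 1 else
      Complex.exp (t (Fin.ofNat (n + 1) (n - i).toNat, σ) * Complex.I) with hu
    have hchar : ∀ x, Complex.exp (inner ℝ (E x) t * Complex.I)
        = ∏ m : Fin (n + 1), ∏ σ, u ((n : ℤ) - (m : ℕ)) σ ^ x m σ := fun x => by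
      have hum : ∀ (m : Fin (n + 1)) σ, u ((n : ℤ) - (m : ℕ)) σ
          = Complex.exp (t (m, σ) * Complex.I) := fun m σ => by
        have hm := m.2
        simp only [hu]
        rw [if_neg (by omega), show ((n : ℤ) - (n - (m : ℕ))).toNat = m by omega]
        simp
      simp_rw [hum, ← Complex.exp_nat_mul]
      rw [← Finset.prod_product', ← Complex.exp_sum, Finset.univ_product_univ]
      congr 1
      rw [PiLp.inner_apply]
      push_cast
      rw [Finset.sum_mul]
      refine Finset.sum_congr rfl fun r _ => ?_
      simp [hE]
      ring
    rw [charFun_apply, charFun_apply, integral_map hEm.aemeasurable (by fun_prop),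
      integral_map hEm.aemeasurable (by fun_prop)]
    simp_rw [hchar]
    refine h u (fun i hi => ?_) fun i σ => ?_
    · funext σ
      simp [hu, hi]
    · simp only [hu]
      split_ifs
      · simp
      · rw [Complex.norm_exp_ofReal_mul_I]
  rw [← hEe.comap_map P, key, hEe.comap_map]

theorem identDistrib_jumpCount {ω : Env} (hω : ∀ x, 0 < prob (ω x) 1) {n : ℕ} (hn : 0 < n)
    (hhit : ∀ᵐ X ∂quenchedLaw ω, ∃ t, HitBy n t X) :
    IdentDistrib
      (fun (X : ℕ → ℤ) (m : Fin (n + 1)) => jumpCount n ((n : ℤ) - (m : ℕ)) X)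
      (fun (Z : ℕ → Fin 3 → ℕ) (m : Fin (n + 1)) => Z m)
      (quenchedLaw ω)
      (branchingLaw fun m => offspringLaw (ω ((n : ℤ) - 1 - m))) := by
  have h1 : AEMeasurable (fun (X : ℕ → ℤ) (m : Fin (n + 1)) =>
      jumpCount n ((n : ℤ) - (m : ℕ)) X) (quenchedLaw ω) :=
    aemeasurable_pi_iff.2 fun m => aemeasurable_jumpCount (by exact_mod_cast hn) hhit _
  have h2 : Measurable fun (Z : ℕ → Fin 3 → ℕ) (m : Fin (n + 1)) => Z m := by fun_prop
  refine ⟨h1, h2.aemeasurable, ?_⟩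
  have hP := Measure.isProbabilityMeasure_map h1
  have hQ := Measure.isProbabilityMeasure_map (h2.aemeasurable
    (μ := branchingLaw fun m => offspringLaw (ω ((n : ℤ) - 1 - m))))
  refine ext_of_integral_prod_pow fun u hu hun => ?_
  rw [integral_map h1 (measurable_of_countable _).aestronglyMeasurable,
    integral_map h2.aemeasurable (measurable_of_countable _).aestronglyMeasurable,
    integral_prod_pow_jumpCount hω hn hhit hu hun, integral_prod_pow_branchingLaw hω n hu hun]

end RWRE

/-! ### The theorem, on the event of positive ω(1) and an existing potential. -/

theorem mainTheorem4 {d : ℕ} {Θ : Set (EuclideanSpace ℝ (Fin d))} (hΘ : IsCompact Θ)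
    (ν : Θ → Measure StepLaw) [∀ θ, IsProbabilityMeasure (ν θ)]
    (hlog : UniformLogMoment ν) (hγ : ∀ θ, topLyapunov (ν θ) < 0) (θ : Θ) :
    ∀ᵐ ω ∂envLaw (ν θ),
      (∀ (i : ℤ) (a b : ℕ),
        offspringLaw (ω i) 0 ![a, b, 0]
            = ENNReal.ofReal (((a + b)! : ℝ) / ((a ! : ℝ) * (b ! : ℝ))
              * prob (ω i) (-1) ^ a * prob (ω i) (-2) ^ b * prob (ω i) 1) ∧
        offspringLaw (ω i) 1 ![a, b, 1]
            = ENNReal.ofReal (((a + b)! : ℝ) / ((a ! : ℝ) * (b ! : ℝ))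
              * prob (ω i) (-1) ^ a * prob (ω i) (-2) ^ b * prob (ω i) 1) ∧
        offspringLaw (ω i) 2 ![a, b, 0]
            = ENNReal.ofReal (((a + b)! : ℝ) / ((a ! : ℝ) * (b ! : ℝ))
              * prob (ω i) (-1) ^ a * prob (ω i) (-2) ^ b * prob (ω i) 1)) ∧
      ∀ n : ℕ, 0 < n →
        (∀ᵐ X ∂quenchedLaw ω, jumpCount n n X = 0) ∧
        IdentDistrib
          (fun (X : ℕ → ℤ) (m : Fin (n + 1)) => jumpCount n ((n : ℤ) - (m : ℕ)) X)
          (fun (Z : ℕ → Fin 3 → ℕ) (m : Fin (n + 1)) => Z m)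
          (quenchedLaw ω)
          (branchingLaw fun m => offspringLaw (ω ((n : ℤ) - 1 - m))) ∧
        ∀ᵐ X ∂quenchedLaw ω, ∃ s : ℕ,
          HasSum (fun k : Set.Iic ((n : ℤ) - 1) => jumpCount n k X ⬝ᵥ ![2, 1, 2]) s ∧
          hittingTime n X = n + s := by
  have hpos := fun l hl => ((hlog l hl).1 θ).1
  filter_upwards [ae_prob_pos (ν θ) (hpos 1 (by simp)),
    ae_exists_potential (ν θ) (hpos 1 (by simp)) ((hlog 1 (by simp)).1 θ).2 (hγ θ)]
    with ω hω hpot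
  obtain ⟨h, h0, hh⟩ := hpot
  refine ⟨fun i a b => ?_, fun n hn => ?_⟩
  · have hp := pairLaw_apply (hω i) (a, b)
    exact ⟨(offspringLaw_apply (ω i) 0 a b).trans hp, (offspringLaw_apply (ω i) 1 a b).trans hp,
      (offspringLaw_apply (ω i) 2 a b).trans hp⟩
  · have hn' : (0 : ℤ) < n := by exact_mod_cast hn
    have hhit := ae_exists_hitBy h0 hh hn'
    refine ⟨?_, identDistrib_jumpCount hω hn hhit, ?_⟩
    · filter_upwards [ae_isWalk ω, hhit] with X hX hhX
      obtain ⟨T, hT⟩ := exists_firstHit hhX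
      exact hT.jumpCount_self hn' hX
    · filter_upwards [ae_isWalk ω, hhit] with X hX hhX
      obtain ⟨T, hT⟩ := exists_firstHit hhX
      exact hT.exists_hasSum hn hX
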